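/- **Setting.** Let $\Sigma$ be a finite alphabet with the discrete topology and let $X\subset\Sigma^{\mathbb Z}$ be a two-sided subshift (a closed subset invariant under the left shift $S$ and its inverse), with language $\mathcal L(X)$, the set of finite words that appear in points of $X$. For $a\in\mathcal L(X)$ and an integer $l\ge 0$ put $\Gamma^+(a)=\{c\in\mathcal L(X): ac\in\mathcal L(X)\}$, $\Gamma^-_l(a)=\{b\in\mathcal L(X): |b|=l,\ ba\in\mathcal L(X)\}$ and $\omega^-_l(a)=\{b\in\mathcal L(X): |b|=l,\ bac\in\mathcal L(X)\text{ for all }c\in\Gamma^+(a)\}$. Let $\mathcal S_l(X)=\{v\in\mathcal L(X):\Gamma^-_l(v)\subset\omega^-_l(v)\}$ be the set of $l$-synchronizing words. The subshift $X$ is *$\lambda$-synchronizing* if for every $w\in\mathcal L(X)$ and every $k$ there is a word $v\in\mathcal S_k(X)\cap\Gamma^+(w)$. **The $\lambda$-graph system.** For a $\lambda$-synchronizing subshift $X$ the $\lambda$-graph system $\mathfrak L^{\lambda(X)}$ is defined as follows. Its vertex set $V_l$ $(l\ge 0)$ is the finite set of classes $[\mu]_l$ of words $\mu\in\mathcal S_l(X)$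 under the relation $\mu\sim_l\nu\Leftrightarrow\Gamma_l^-(\mu)=\Gamma_l^-(\nu)$. For each $\nu\in\mathcal S_{l+1}(X)$ and each symbol $\alpha\in\Gamma^-_1(\nu)$ there is an edge labeled $\alpha$ from $[\alpha\nu]_l\in V_l$ to $[\nu]_{l+1}\in V_{l+1}$, edges with the same source, label and terminal vertex being identified. The map $\iota:V_{l+1}\to V_l$ is $[\mu]_{l+1}\mapsto[\mu]_l$. For $u\in V_l$ and $v\in V_{l+1}$ let $M_{l,l+1}(u,v)$ be the number of edges from $u$ to $v$, and let $I_{l,l+1}(u,v)=1$ if $\iota(v)=u$ and $0$ otherwise; then $I_{l,l+1}M_{l+1,l+2}=M_{l,l+1}I_{l+1,l+2}$. **The invariants.** Let $\mathbb Z_{I^t}=\varinjlim\{I_{l,l+1}^t:\mathbb Z^{V_l}\to\mathbb Z^{V_{l+1}}\}$, let $\mathbb Z_{I^t}^+\subset\mathbb Z_{I^t}$ be the set of classes of vectors with nonnegative entries, and let $\lambda$ be the endomorphism of $\mathbb Z_{I^t}$ induced by the maps $M_{l,l+1}^t$. Let $\mathbb Z_I=\varprojlim\{I_{l,l+1}:\mathbb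 Z^{V_{l+1}}\to\mathbb Z^{V_l}\}$ with its endomorphism $M:(x_l)_l\mapsto(M_{l,l+1}x_{l+1})_l$. Put $$K_0^\lambda(X)=\mathbb Z_{I^t}/(\mathrm{id}-\lambda)\mathbb Z_{I^t},\quad K_1^\lambda(X)=\ker(\mathrm{id}-\lambda)\subset\mathbb Z_{I^t},$$ $$BF^0_\lambda(X)=\mathbb Z_I/(\mathrm{id}-M)\mathbb Z_I,\quad BF^1_\lambda(X)=\ker(\mathrm{id}-M)\subset\mathbb Z_I,$$ $$\Delta^\lambda(X)=\varinjlim\{\mathbb Z_{I^t}\xrightarrow{\lambda}\mathbb Z_{I^t}\xrightarrow{\lambda}\cdots\},$$ where $\Delta^\lambda(X)$ is ordered by the positive cone $\Delta^\lambda_+(X)=\varinjlim\{\mathbb Z^+_{I^t}\xrightarrow{\lambda}\mathbb Z^+_{I^t}\xrightarrow{\lambda}\cdots\}\subset\Delta^\lambda(X)$. Finally, with $P_l$ the set of labeled edge paths of $\mathfrak L^{\lambda(X)}$ that start at a vertex in $V_0$ and terminate at a vertex in $V_l$, put $$h_\lambda(X)=\limsup_{l\to\infty}\tfrac1l\log\#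 V_l,\qquad h^\lambda_{vol}(X)=\limsup_{l\to\infty}\tfrac1l\log\# P_l\qquad(\text{in }[0,\infty]).$$ **Corollary 3.6.** Let $X$ and $X'$ be $\lambda$-synchronizing subshifts, over possibly different finite alphabets, that are topologically conjugate (there is a homeomorphism $X\to X'$ that commutes with the shifts). Then for $i=0,1$ there are isomorphisms of abelian groups $K_i^\lambda(X)\cong K_i^\lambda(X')$ and $BF^i_\lambda(X)\cong BF^i_\lambda(X')$; there is a group isomorphism $\Delta^\lambda(X)\to\Delta^\lambda(X')$ that maps $\Delta^\lambda_+(X)$ onto $\Delta^\lambda_+(X')$; and $h_\lambda(X)=h_\lambda(X')$ and $h^\lambda_{vol}(X)=h^\lambda_{vol}(X')$. -/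

import Mathlib

noncomputable section

namespace LambdaSync

universe u v

/-! ## Sequential inductive limits of abelian groups -/

section SeqLimit

variable {G : ℕ → Type u} [∀ i, AddCommGroup (G i)]

/-- The composite `G i → G (i+1) → ⋯ → G j` of a sequence of homomorphisms. -/
def stepMap (f : ∀ i, G i →+ G (i + 1)) (i j : ℕ) (h : i ≤ j) : G i →+ G j :=
  Nat.leRec (motive := fun j _ => G i →+ G j) (AddMonoidHom.id (G i))
    (fun k _ g => (f k).comp g) h

theorem stepMap_self (f : ∀ i, G i →+ G (i + 1)) (i : ℕ) :
    stepMap f i i le_rfl = AddMonoidHom.id (G i) := by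
  simp [stepMap]

theorem stepMap_succ (f : ∀ i, G i →+ G (i + 1)) (i j : ℕ) (h : i ≤ j) :
    stepMap f i (j + 1) (Nat.le_succ_of_le h) = (f j).comp (stepMap f i j h) := by
  unfold stepMap
  exact Nat.leRec_succ (motive := fun j _ => G i →+ G j) (AddMonoidHom.id (G i))
    (fun k _ g => (f k).comp g) h

/-- The inductive limit `lim (G 0 → G 1 → G 2 → ⋯)` of abelian groups. -/
abbrev SeqLimit (f : ∀ i, G i →+ G (i + 1)) : Type u :=
  AddCommGroup.DirectLimit G (stepMap f)

/-- The canonical map from the `l`-th group into the inductive limit. -/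
def SeqLimit.of (f : ∀ i, G i →+ G (i + 1)) (l : ℕ) : G l →+ SeqLimit f :=
  AddCommGroup.DirectLimit.of G (stepMap f) l

theorem SeqLimit.of_step (f : ∀ i, G i →+ G (i + 1)) (l : ℕ) (x : G l) :
    SeqLimit.of f (l + 1) (f l x) = SeqLimit.of f l x := by
  have h := AddCommGroup.DirectLimit.of_f (G := G) (f := stepMap f)
    (hij := Nat.le_succ_of_le (le_refl l)) (x := x)
  rw [stepMap_succ f l l (le_refl l), stepMap_self] at h
  exact h

/-- The homomorphism out of the inductive limit given by a compatible sequence of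
homomorphisms. -/
def SeqLimit.lift (f : ∀ i, G i →+ G (i + 1)) {P : Type v} [AddCommGroup P]
    (g : ∀ i, G i →+ P) (hg : ∀ i x, g (i + 1) (f i x) = g i x) : SeqLimit f →+ P :=
  AddCommGroup.DirectLimit.lift G (stepMap f) P g (by
    intro i j hij x
    induction j, hij using Nat.le_induction with
    | base => rw [stepMap_self]; rfl
    | succ k hk ih =>
      rw [stepMap_succ f i k hk, AddMonoidHom.comp_apply, hg, ih])

end SeqLimit

/-! ## Nonnegative matrix systems and their invariants -/

/-- A nonnegative matrix system `(M, I)`; the rows of `M l` and `I l` are indexed by the finite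
set `V l`, the columns by `V (l+1)`. -/
structure NonnegMatrixSystem where
  V : ℕ → Type u
  fintypeV : ∀ l, Fintype (V l)
  M : ∀ l, Matrix (V l) (V (l + 1)) ℕ
  I : ∀ l, Matrix (V l) (V (l + 1)) ℕ
  I_zero_one : ∀ l i j, I l i j = 0 ∨ I l i j = 1
  I_row : ∀ l i, ∃ j, I l i j = 1
  I_col : ∀ l j, ∃! i, I l i j = 1
  comm : ∀ l, I l * M (l + 1) = M l * I (l + 1)

namespace NonnegMatrixSystem

attribute [instance] NonnegMatrixSystem.fintypeV

variable (S : NonnegMatrixSystem.{u})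

/-- `M l` as an integer matrix. -/
def MZ (l : ℕ) : Matrix (S.V l) (S.V (l + 1)) ℤ := (S.M l).map (fun n => (n : ℤ))

/-- `I l` as an integer matrix. -/
def IZ (l : ℕ) : Matrix (S.V l) (S.V (l + 1)) ℤ := (S.I l).map (fun n => (n : ℤ))

theorem comm_int (l : ℕ) : S.IZ l * S.MZ (l + 1) = S.MZ l * S.IZ (l + 1) := by
  have h := congrArg (fun N => Matrix.map N (Nat.castRingHom ℤ)) (S.comm l)
  simp only [Matrix.map_mul] at h
  exact h

/-- `I_{l,l+1}^t : ℤ^{m(l)} → ℤ^{m(l+1)}`. -/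
def It (l : ℕ) : (S.V l → ℤ) →+ (S.V (l + 1) → ℤ) :=
  (S.IZ l).transpose.mulVecLin.toAddMonoidHom

/-- `M_{l,l+1}^t : ℤ^{m(l)} → ℤ^{m(l+1)}`. -/
def Mt (l : ℕ) : (S.V l → ℤ) →+ (S.V (l + 1) → ℤ) :=
  (S.MZ l).transpose.mulVecLin.toAddMonoidHom

theorem Mt_It (l : ℕ) (x : S.V l → ℤ) :
    S.Mt (l + 1) (S.It l x) = S.It (l + 1) (S.Mt l x) := by
  have h := congrArg Matrix.transpose (S.comm_int l)
  simp only [Matrix.transpose_mul] at h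
  change (S.MZ (l + 1)).transpose.mulVec ((S.IZ l).transpose.mulVec x) =
    (S.IZ (l + 1)).transpose.mulVec ((S.MZ l).transpose.mulVec x)
  rw [Matrix.mulVec_mulVec, Matrix.mulVec_mulVec, h]

/-- The group `ℤ_{I^t}`, the inductive limit of the maps `I_{l,l+1}^t`. -/
abbrev ZIt : Type u := SeqLimit S.It

/-- The endomorphism `λ_{(M,I)}` of `ℤ_{I^t}` induced by the maps `M_{l,l+1}^t`. -/
def lam : S.ZIt →+ S.ZIt :=
  SeqLimit.lift S.It (fun l => (SeqLimit.of S.It (l + 1)).comp (S.Mt l)) (by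
    intro l x
    simp only [AddMonoidHom.comp_apply]
    rw [S.Mt_It, SeqLimit.of_step])

/-- `K_0(M,I) = ℤ_{I^t} / (id - λ_{(M,I)}) ℤ_{I^t}`. -/
abbrev K0 : Type u := S.ZIt ⧸ (AddMonoidHom.id S.ZIt - S.lam).range

/-- `K_1(M,I)`, the kernel of `id - λ_{(M,I)}` in `ℤ_{I^t}`. -/
abbrev K1 : Type u := (AddMonoidHom.id S.ZIt - S.lam).ker

/-- The positive cone of `ℤ_{I^t}`: the classes of nonnegative vectors. -/
def ZItPos : Set S.ZIt :=
  {z | ∃ (l : ℕ) (x : S.V l → ℤ), (∀ i, 0 ≤ x i) ∧ SeqLimit.of S.It l x = z}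

/-- The dimension group `Δ_{(M,I)}`, the inductive limit of
`λ_{(M,I)} : ℤ_{I^t} → ℤ_{I^t} → ⋯`. -/
abbrev Delta : Type u := SeqLimit (G := fun _ => S.ZIt) (fun _ => S.lam)

/-- The positive cone `Δ⁺_{(M,I)}` of the dimension group: the inductive limit of the positive
cones of `ℤ_{I^t}`, as a subset of `Δ_{(M,I)}`. -/
def DeltaPos : Set S.Delta :=
  {z | ∃ (k : ℕ) (y : S.ZIt), y ∈ S.ZItPos ∧
    SeqLimit.of (G := fun _ => S.ZIt) (fun _ => S.lam) k y = z}

/-- The group `ℤ_I`, the projective limit of `I_{l,l+1} : ℤ^{m(l+1)} → ℤ^{m(l)}`. -/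
def ZI : AddSubgroup (∀ l, S.V l → ℤ) where
  carrier := {x | ∀ l, (S.IZ l).mulVec (x (l + 1)) = x l}
  zero_mem' := by intro l; simp
  add_mem' := by
    intro x y hx hy l
    simp only [Pi.add_apply, Matrix.mulVec_add]
    rw [hx l, hy l]
  neg_mem' := by
    intro x hx l
    simp only [Pi.neg_apply, Matrix.mulVec_neg]
    rw [hx l]

/-- The endomorphism of `ℤ_I` given by the matrices `M_{l,l+1}`. -/
def Mend : S.ZI →+ S.ZI where
  toFun x := ⟨fun l => (S.MZ l).mulVec (x.1 (l + 1)), by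
    intro l
    have hx := x.2 (l + 1)
    change (S.IZ l).mulVec ((S.MZ (l + 1)).mulVec (x.1 (l + 1 + 1))) =
      (S.MZ l).mulVec (x.1 (l + 1))
    rw [← hx, Matrix.mulVec_mulVec, Matrix.mulVec_mulVec, S.comm_int]⟩
  map_zero' := by
    apply Subtype.ext; funext l; simp
  map_add' x y := by
    apply Subtype.ext; funext l; simp [Matrix.mulVec_add]

/-- `BF^0(M,I) = ℤ_I / (I - M) ℤ_I`. -/
abbrev BF0 : Type u := S.ZI ⧸ (AddMonoidHom.id S.ZI - S.Mend).range

/-- `BF^1(M,I)`, the kernel of `I - M` in `ℤ_I`. -/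
abbrev BF1 : Type u := (AddMonoidHom.id S.ZI - S.Mend).ker

end NonnegMatrixSystem

/-! ## λ-graph systems -/

/-- A λ-graph system over the alphabet `A`. An edge `e : E l` leads from the vertex `s e` in `V l`
to the vertex `t e` in `V (l+1)`. The field `local_property` is the label-preserving bijection
between `E^ι(u,v)` and `E_ι(u,v)`; it contains the requirement that an edge with label `α` and
terminal `v` exists if and only if one with label `α` and terminal `ι v` exists. -/
structure LambdaGraphSystem (A : Type u) where
  V : ℕ → Type u
  E : ℕ → Type u
  finiteV : ∀ l, Finite (V l)
  finiteE : ∀ l, Finite (E l)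
  s : ∀ {l}, E l → V l
  t : ∀ {l}, E l → V (l + 1)
  label : ∀ {l}, E l → A
  iota : ∀ {l}, V (l + 1) → V l
  iota_surjective : ∀ l, Function.Surjective (iota (l := l))
  local_property : ∀ (l : ℕ) (u : V l) (v : V (l + 1 + 1)),
    ∃ φ : {e : E (l + 1) // t e = v ∧ iota (s e) = u} ≃ {e : E l // s e = u ∧ t e = iota v},
      ∀ e, label (φ e).1 = label e.1

namespace LambdaGraphSystem

variable {A : Type u} (L : LambdaGraphSystem A)

/-- Paths of length `l` that start at a vertex in `V 0`, indexed by their terminal vertex. -/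
inductive Path : (l : ℕ) → L.V l → Type u
  | nil (v : L.V 0) : Path 0 v
  | cons {l : ℕ} (e : L.E l) (p : Path l (L.s e)) : Path (l + 1) (L.t e)

/-- The set `P_l(L)` of the labeled paths that start at a vertex in `V 0` and terminate at a
vertex in `V l`. -/
abbrev PathsTo (l : ℕ) : Type u := Σ v : L.V l, L.Path l v

/-- The λ-entropy: the exponential growth rate of the number of vertices in `V l`
(it may be `+∞`). -/
def lambdaEntropy : EReal :=
  Filter.limsup (fun l : ℕ => ((Real.log (Nat.card (L.V l)) / l : ℝ) : EReal)) Filter.atTop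

/-- The volume entropy: the exponential growth rate of the number of paths in `P_l(L)`
(it may be `+∞`). -/
def volumeEntropy : EReal :=
  Filter.limsup (fun l : ℕ => ((Real.log (Nat.card (L.PathsTo l)) / l : ℝ) : EReal)) Filter.atTop

/-- The entry of `M l` at `(u, v)`: the number of edges from `u` to `v`. -/
def edgeCount (l : ℕ) (u : L.V l) (v : L.V (l + 1)) : ℕ :=
  Nat.card {e : L.E l // L.s e = u ∧ L.t e = v}

open Classical in
/-- The entry of `I l` at `(u, v)`: it is `1` if `ι v = u`, and `0` otherwise. -/
def iotaEntry (l : ℕ) (u : L.V l) (v : L.V (l + 1)) : ℕ :=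
  if L.iota v = u then 1 else 0

/-- The nonnegative matrix system `(M, I)` of a λ-graph system. -/
def matrixSystem : NonnegMatrixSystem.{u} where
  V := L.V
  fintypeV l := @Fintype.ofFinite (L.V l) (L.finiteV l)
  M l := Matrix.of (L.edgeCount l)
  I l := Matrix.of (L.iotaEntry l)
  I_zero_one l i j := by
    simp only [Matrix.of_apply, iotaEntry]
    split_ifs <;> simp
  I_row l i := by
    obtain ⟨j, hj⟩ := L.iota_surjective l i
    exact ⟨j, by simp [iotaEntry, hj]⟩
  I_col l j := by
    refine ⟨L.iota j, by simp [iotaEntry], ?_⟩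
    intro i hi
    by_contra hne
    have : L.iotaEntry l i j = 0 := by
      simp [iotaEntry, Ne.symm hne]
    simp [this] at hi
  comm l := by
    classical
    have : ∀ k, Finite (L.V k) := L.finiteV
    have : ∀ k, Finite (L.E k) := L.finiteE
    let _ : ∀ k, Fintype (L.V k) := fun k => @Fintype.ofFinite (L.V k) (L.finiteV k)
    ext u v
    simp only [Matrix.mul_apply, Matrix.of_apply]
    obtain ⟨φ, -⟩ := L.local_property l u v
    have hR : ∑ w, L.edgeCount l u w * L.iotaEntry (l + 1) w v = L.edgeCount l u (L.iota v) := by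
      rw [Finset.sum_eq_single (L.iota v)]
      · simp [iotaEntry]
      · intro b _ hb
        simp [iotaEntry, Ne.symm hb]
      · simp
    have hL : ∑ w, L.iotaEntry l u w * L.edgeCount (l + 1) w v =
        Nat.card {e : L.E (l + 1) // L.t e = v ∧ L.iota (L.s e) = u} := by
      let ψ : {e : L.E (l + 1) // L.t e = v ∧ L.iota (L.s e) = u} ≃
          Σ w : L.V (l + 1), {e : L.E (l + 1) // (L.s e = w ∧ L.t e = v) ∧ L.iota w = u} :=
        { toFun := fun e => ⟨L.s e.1, e.1, ⟨rfl, e.2.1⟩, e.2.2⟩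
          invFun := fun p => ⟨p.2.1, p.2.2.1.2, by rw [p.2.2.1.1]; exact p.2.2.2⟩
          left_inv := fun e => rfl
          right_inv := by
            rintro ⟨w, e, ⟨rfl, h2⟩, h3⟩
            rfl }
      rw [Nat.card_congr ψ, Nat.card_sigma]
      refine Finset.sum_congr rfl fun w _ => ?_
      by_cases h : L.iota w = u
      · simp [iotaEntry, h, edgeCount]
      · simp [iotaEntry, h]
    exact hL.trans ((Nat.card_congr φ).trans hR.symm)

end LambdaGraphSystem

/-! ## Subshifts, λ-synchronization and the λ-synchronizing λ-graph system -/

section Subshift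

variable {A : Type u} [TopologicalSpace A]

/-- Two-sided subshifts: closed shift-invariant subsets of `A^ℤ`. -/
abbrev ZSubshift (A : Type u) [TopologicalSpace A] : Type u :=
  SymbolicDynamics.FullShift.Subshift A ℤ

/-- Topological conjugacy: a homeomorphism that intertwines the left shifts. -/
def TopologicallyConjugate {A : Type u} {B : Type v} [TopologicalSpace A] [TopologicalSpace B]
    (X : ZSubshift A) (Y : ZSubshift B) : Prop :=
  ∃ φ : X.carrier ≃ₜ Y.carrier, ∀ x : X.carrier,
    (φ ⟨SymbolicDynamics.FullShift.shift (1 : ℤ) x.1, X.mapsTo 1 x.2⟩ : ℤ → B) =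
      SymbolicDynamics.FullShift.shift (1 : ℤ) (φ x : ℤ → B)

variable (X : ZSubshift A)

/-- The language `𝓛(X)`: the words that appear somewhere in a point of `X`. -/
def language : Set (List A) :=
  {w | ∃ x ∈ X.carrier, ∃ i : ℤ, ∀ (j : ℕ) (hj : j < w.length), x (i + j) = w[j]}

/-- `Γ⁺(a)`, the set of followers of a word. -/
def gammaPlus (a : List A) : Set (List A) :=
  {c | c ∈ language X ∧ a ++ c ∈ language X}

/-- `Γ⁻_l(a)`, the set of predecessors of length `l` of a word. -/
def gammaMinus (l : ℕ) (a : List A) : Set (List A) :=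
  {b | b ∈ language X ∧ b.length = l ∧ b ++ a ∈ language X}

/-- `ω⁻_l(a)`, the set of words `b` of length `l` such that `b a c` is admissible for all
`c` in `Γ⁺(a)`. -/
def omegaMinus (l : ℕ) (a : List A) : Set (List A) :=
  {b | b ∈ language X ∧ b.length = l ∧ ∀ c ∈ gammaPlus X a, b ++ a ++ c ∈ language X}

/-- `𝓢_l(X)`, the set of `l`-synchronizing words. -/
def syncWords (l : ℕ) : Set (List A) :=
  {v | v ∈ language X ∧ gammaMinus X l v ⊆ omegaMinus X l v}

/-- λ-synchronization. -/
def IsLambdaSynchronizing : Prop :=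
  ∀ w ∈ language X, ∀ k : ℕ, ∃ v, v ∈ syncWords X k ∧ v ∈ gammaPlus X w

variable {X}

theorem language_infix {a b c : List A} (h : a ++ b ++ c ∈ language X) : b ∈ language X := by
  obtain ⟨x, hx, i, hi⟩ := h
  refine ⟨x, hx, i + a.length, fun j hj => ?_⟩
  have h2 := hi (a.length + j) (by simp; omega)
  rw [List.getElem_append_left (by simp; omega), List.getElem_append_right (by omega)] at h2
  simp only [Nat.add_sub_cancel_left] at h2
  rw [← h2]
  push_cast
  rw [add_assoc]

theorem language_left {a b : List A} (h : a ++ b ∈ language X) : a ∈ language X :=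
  language_infix (a := []) (c := b) (by simpa using h)

theorem language_right {a b : List A} (h : a ++ b ∈ language X) : b ∈ language X :=
  language_infix (a := a) (c := []) (by simpa using h)

/-- Every predecessor set of length `l` is determined by the one of length `l + 1`. -/
theorem mem_gammaMinus_iff {l : ℕ} {a b : List A} :
    b ∈ gammaMinus X l a ↔ ∃ y, y :: b ∈ gammaMinus X (l + 1) a := by
  constructor
  · rintro ⟨_, hl, x, hx, i, hi⟩
    have key : x (i - 1) :: (b ++ a) ∈ language X := by
      refine ⟨x, hx, i - 1, fun j hj => ?_⟩
      cases j with
      | zero => simp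
      | succ j =>
        have := hi j (by simpa using hj)
        rw [List.getElem_cons_succ, ← this]
        congr 1
        push_cast
        ring
    refine ⟨x (i - 1), ?_, by simp [hl], by simpa using key⟩
    exact language_left (b := a) (by simpa using key)
  · rintro ⟨y, _, hl, h⟩
    have h2 : b ++ a ∈ language X := language_right (a := [y]) (by simpa using h)
    exact ⟨language_left h2, by simpa using hl, h2⟩

theorem gammaMinus_succ_eq {l : ℕ} {a a' : List A}
    (h : gammaMinus X (l + 1) a = gammaMinus X (l + 1) a') :
    gammaMinus X l a = gammaMinus X l a' := by
  ext b
  rw [mem_gammaMinus_iff, mem_gammaMinus_iff, h]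

theorem mem_gammaMinus_cons {l : ℕ} {α : A} {ν b : List A} :
    b ∈ gammaMinus X l (α :: ν) ↔ b ++ [α] ∈ gammaMinus X (l + 1) ν := by
  constructor
  · rintro ⟨_, hl, h⟩
    have h2 : (b ++ [α]) ++ ν ∈ language X := by simpa using h
    exact ⟨language_left h2, by simp [hl], h2⟩
  · rintro ⟨_, hl, h⟩
    have h2 : b ++ (α :: ν) ∈ language X := by simpa using h
    exact ⟨language_left h2, by simpa using hl, h2⟩

theorem gammaMinus_cons_eq {l : ℕ} {α : A} {ν ν' : List A}
    (h : gammaMinus X (l + 1) ν = gammaMinus X (l + 1) ν') :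
    gammaMinus X l (α :: ν) = gammaMinus X l (α :: ν') := by
  ext b
  rw [mem_gammaMinus_cons, mem_gammaMinus_cons, h]

/-- `𝓢_{l+1}(X) ⊆ 𝓢_l(X)`. -/
theorem syncWords_succ {l : ℕ} {v : List A} (h : v ∈ syncWords X (l + 1)) :
    v ∈ syncWords X l := by
  refine ⟨h.1, fun b hb => ⟨hb.1, hb.2.1, fun c hc => ?_⟩⟩
  obtain ⟨y, hy⟩ := mem_gammaMinus_iff.1 hb
  have := (h.2 hy).2.2 c hc
  exact language_right (a := [y]) (by simpa using this)

/-- If `ν ∈ 𝓢_{l+1}(X)` and `α ∈ Γ⁻_1(ν)`, then `αν ∈ 𝓢_l(X)`. -/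
theorem cons_mem_syncWords {l : ℕ} {α : A} {ν : List A} (h : ν ∈ syncWords X (l + 1))
    (hα : [α] ∈ gammaMinus X 1 ν) : α :: ν ∈ syncWords X l := by
  refine ⟨by simpa using hα.2.2, fun b hb => ⟨hb.1, hb.2.1, fun c hc => ?_⟩⟩
  have h2 := (h.2 (mem_gammaMinus_cons.1 hb)).2.2 c
    ⟨hc.1, language_right (a := [α]) (by simpa using hc.2)⟩
  simpa using h2

theorem cons_mem_gammaMinus_iff {l : ℕ} {α : A} {ν : List A} :
    [α] ∈ gammaMinus X 1 ν ↔ ∃ b, b ∈ gammaMinus X l (α :: ν) := by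
  induction l with
  | zero =>
    constructor
    · intro h
      exact ⟨[], mem_gammaMinus_cons.2 (by simpa using h)⟩
    · rintro ⟨b, hb⟩
      have hb0 : b = [] := List.length_eq_zero_iff.1 hb.2.1
      subst hb0
      simpa using mem_gammaMinus_cons.1 hb
  | succ l ih =>
    rw [ih]
    constructor
    · rintro ⟨b, hb⟩
      obtain ⟨y, hy⟩ := mem_gammaMinus_iff.1 hb
      exact ⟨_, hy⟩
    · rintro ⟨b, hb⟩
      cases b with
      | nil => exact absurd hb.2.1 (by simp)
      | cons y b => exact ⟨b, mem_gammaMinus_iff.2 ⟨y, hb⟩⟩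

theorem singleton_mem_gammaMinus_congr {l : ℕ} {α : A} {ν ν' : List A}
    (h : gammaMinus X (l + 1) ν = gammaMinus X (l + 1) ν') :
    [α] ∈ gammaMinus X 1 ν ↔ [α] ∈ gammaMinus X 1 ν' := by
  rw [cons_mem_gammaMinus_iff (l := l), cons_mem_gammaMinus_iff (l := l), gammaMinus_cons_eq h]

variable (X)

/-- `l`-past equivalence on `𝓢_l(X)`. -/
def pastSetoid (l : ℕ) : Setoid (syncWords X l) :=
  Setoid.ker (fun v => gammaMinus X l v.1)

/-- The vertices at level `l`: the `l`-past equivalence classes of `𝓢_l(X)`. -/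
def Vertex (l : ℕ) : Type u := Quotient (pastSetoid X l)

variable {X}

/-- The class `[μ]_l`. -/
def vertexMk {l : ℕ} (μ : syncWords X l) : Vertex X l := Quotient.mk (pastSetoid X l) μ

theorem vertexMk_eq {l : ℕ} {μ ν : syncWords X l} :
    vertexMk μ = vertexMk ν ↔ gammaMinus X l μ.1 = gammaMinus X l ν.1 :=
  Quotient.eq (r := pastSetoid X l)

theorem vertexMk_surjective {l : ℕ} (v : Vertex X l) : ∃ μ : syncWords X l, vertexMk μ = v :=
  Quotient.exists_rep v

/-- The map `[μ]_{l+1} ↦ [μ]_l`. -/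
def vertexIota {l : ℕ} : Vertex X (l + 1) → Vertex X l :=
  Quotient.lift (s := pastSetoid X (l + 1))
    (fun μ : syncWords X (l + 1) => vertexMk (l := l) ⟨μ.1, syncWords_succ μ.2⟩)
    (fun _ _ h => vertexMk_eq.2 (gammaMinus_succ_eq h))

theorem vertexIota_mk {l : ℕ} (μ : syncWords X (l + 1)) :
    vertexIota (vertexMk μ) = vertexMk (l := l) ⟨μ.1, syncWords_succ μ.2⟩ := rfl

variable (X)

/-- The edges from level `l` to level `l + 1`, as triples (source, label, terminal): for
`ν ∈ 𝓢_{l+1}(X)` and `α ∈ Γ⁻_1(ν)` there is an edge with label `α` from `[αν]_l` to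
`[ν]_{l+1}`. -/
def Edge (l : ℕ) : Type u :=
  {e : Vertex X l × A × Vertex X (l + 1) //
    ∃ (ν : syncWords X (l + 1)) (h : [e.2.1] ∈ gammaMinus X 1 ν.1),
      e.1 = vertexMk ⟨e.2.1 :: ν.1, cons_mem_syncWords ν.2 h⟩ ∧ e.2.2 = vertexMk ν}

variable {X}

theorem finite_vertex [Finite A] (l : ℕ) : Finite (Vertex X l) := by
  let W : Set (List A) := {w | w.length = l}
  have hW : W.Finite := List.finite_length_eq A l
  have hP : (𝒫 W).Finite := hW.finite_subsets
  have := hP.to_subtype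
  let f : Vertex X l → 𝒫 W := Quotient.lift (s := pastSetoid X l)
    (fun μ => ⟨gammaMinus X l μ.1, fun b hb => hb.2.1⟩)
    (fun _ _ h => Subtype.ext h)
  refine Finite.of_injective f ?_
  intro a b hab
  obtain ⟨μ, rfl⟩ := vertexMk_surjective a
  obtain ⟨ν, rfl⟩ := vertexMk_surjective b
  exact vertexMk_eq.2 (congrArg Subtype.val hab)

theorem vertexIota_surjective (hX : IsLambdaSynchronizing X) (l : ℕ) :
    Function.Surjective (vertexIota (X := X) (l := l)) := by
  intro v
  obtain ⟨μ, rfl⟩ := vertexMk_surjective v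
  obtain ⟨ν, hν, hμν⟩ := hX μ.1 μ.2.1 (l + 1 + μ.1.length)
  have hs : μ.1 ++ ν ∈ syncWords X (l + 1) := by
    refine ⟨hμν.2, fun b hb => ⟨hb.1, hb.2.1, fun c hc => ?_⟩⟩
    have h1 : (b ++ μ.1) ++ ν ∈ language X := by simpa using hb.2.2
    have h2 : b ++ μ.1 ∈ gammaMinus X (l + 1 + μ.1.length) ν :=
      ⟨language_left h1, by simp [hb.2.1], h1⟩
    have h3 := (hν.2 h2).2.2 c
      ⟨hc.1, language_right (a := μ.1) (by simpa using hc.2)⟩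
    simpa using h3
  refine ⟨vertexMk ⟨μ.1 ++ ν, hs⟩, ?_⟩
  rw [vertexIota_mk, vertexMk_eq]
  ext b
  constructor
  · rintro ⟨hb, hl, h⟩
    exact ⟨hb, hl, language_left (b := ν) (by simpa using h)⟩
  · intro hb
    exact ⟨hb.1, hb.2.1, by simpa using (μ.2.2 hb).2.2 ν hμν⟩

/-- Sufficient and necessary condition for a triple to be an edge, at a given representative of
the terminal vertex. -/
theorem edge_iff {l : ℕ} {u : Vertex X l} {α : A} (ν : syncWords X (l + 1)) :
    (∃ (ν' : syncWords X (l + 1)) (h : [α] ∈ gammaMinus X 1 ν'.1),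
      u = vertexMk ⟨α :: ν'.1, cons_mem_syncWords ν'.2 h⟩ ∧ vertexMk ν = vertexMk ν') ↔
    ∃ h : [α] ∈ gammaMinus X 1 ν.1, u = vertexMk ⟨α :: ν.1, cons_mem_syncWords ν.2 h⟩ := by
  constructor
  · rintro ⟨ν', h, rfl, h2⟩
    have h3 := vertexMk_eq.1 h2
    exact ⟨(singleton_mem_gammaMinus_congr h3).2 h, vertexMk_eq.2 (gammaMinus_cons_eq h3.symm)⟩
  · rintro ⟨h, hu⟩
    exact ⟨ν, h, hu, rfl⟩

theorem edge_local_property (l : ℕ) (u : Vertex X l) (v : Vertex X (l + 1 + 1)) :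
    ∃ φ : {e : Edge X (l + 1) // e.1.2.2 = v ∧ vertexIota e.1.1 = u} ≃
        {e : Edge X l // e.1.1 = u ∧ e.1.2.2 = vertexIota v},
      ∀ e, (φ e).1.1.2.1 = e.1.1.2.1 := by
  obtain ⟨ν, rfl⟩ := vertexMk_surjective v
  let f : {e : Edge X (l + 1) // e.1.2.2 = vertexMk ν ∧ vertexIota e.1.1 = u} → A :=
    fun e => e.1.1.2.1
  let g : {e : Edge X l // e.1.1 = u ∧ e.1.2.2 = vertexIota (vertexMk ν)} → A :=
    fun e => e.1.1.2.1
  have hf : Function.Injective f := by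
    rintro ⟨⟨⟨a, α, b⟩, he⟩, h0, h1⟩ ⟨⟨⟨a', α', b'⟩, he'⟩, h2, h3⟩ (rfl : α = α')
    dsimp only at h0 h1 h2 h3 he he'
    subst h0 h2
    obtain ⟨h4, rfl⟩ := (edge_iff ν).1 he
    obtain ⟨h5, rfl⟩ := (edge_iff ν).1 he'
    rfl
  have hg : Function.Injective g := by
    rintro ⟨⟨⟨a, α, b⟩, he⟩, h0, h1⟩ ⟨⟨⟨a', α', b'⟩, he'⟩, h2, h3⟩ (rfl : α = α')
    dsimp only at h0 h1 h2 h3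
    subst h0 h1 h2 h3
    rfl
  have hr : Set.range f = Set.range g := by
    ext α
    constructor
    · rintro ⟨⟨⟨⟨a, β, b⟩, he⟩, h0, h1⟩, rfl⟩
      dsimp only at h0 h1 he
      subst h0
      obtain ⟨h4, rfl⟩ := (edge_iff ν).1 he
      refine ⟨⟨⟨(u, β, vertexIota (vertexMk ν)), ?_⟩, rfl, rfl⟩, rfl⟩
      exact ⟨⟨ν.1, syncWords_succ ν.2⟩, h4, h1.symm, rfl⟩
    · rintro ⟨⟨⟨⟨a, β, b⟩, he⟩, h0, h1⟩, rfl⟩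
      dsimp only at h0 h1 he
      subst h0 h1
      obtain ⟨h4, h5⟩ := (edge_iff (⟨ν.1, syncWords_succ ν.2⟩ : syncWords X (l + 1))).1 he
      refine ⟨⟨⟨(vertexMk ⟨β :: ν.1, cons_mem_syncWords ν.2 h4⟩, β, vertexMk ν), ?_⟩,
        rfl, ?_⟩, rfl⟩
      · exact ⟨ν, h4, rfl, rfl⟩
      · exact h5.symm
  refine ⟨(Equiv.ofInjective f hf).trans
    ((Equiv.setCongr hr).trans (Equiv.ofInjective g hg).symm), fun e => ?_⟩
  have := Equiv.apply_ofInjective_symm hg ((Equiv.setCongr hr) (Equiv.ofInjective f hf e))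
  exact this

/-- The λ-synchronizing λ-graph system `𝔏^{λ(X)}` of a λ-synchronizing subshift. -/
def lambdaSyncSystem [Finite A] (X : ZSubshift A) (hX : IsLambdaSynchronizing X) :
    LambdaGraphSystem A where
  V := Vertex X
  E := Edge X
  finiteV := finite_vertex
  finiteE l := by
    have := finite_vertex (X := X) l
    have := finite_vertex (X := X) (l + 1)
    unfold Edge
    infer_instance
  s e := e.1.1
  t e := e.1.2.2
  label e := e.1.2.1
  iota := vertexIota
  iota_surjective := vertexIota_surjective hX
  local_property := edge_local_property

/-- The nonnegative matrix system `(M^{λ(X)}, I^{λ(X)})` of `𝔏^{λ(X)}`. -/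
def lambdaMatrixSystem [Finite A] (X : ZSubshift A) (hX : IsLambdaSynchronizing X) :
    NonnegMatrixSystem.{u} :=
  (lambdaSyncSystem X hX).matrixSystem

end Subshift

end LambdaSync

end

noncomputable section

namespace LambdaSync

universe u v

/-! ## Shift equivalence of endomorphisms of abelian groups -/

/-! The vertices can be replaced by dynamics on one-sided sequences. Call a ray regular if, for
every `l`, its set of pasts of length `l` is locally constant at it; by compactness this means that
for each `l` some prefix is `l`-synchronizing. Then vertices of level `l` are classes of regular
rays with equal past of length `l` (`Reg.vtx_eq_iff`, `Reg.vtx_surjective`), and edges into the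
class of `r` are the shift preimages of `r` (`Reg.exists_edge`, `Reg.exists_of_edge`). Consequently
`ℤ_{I^t}` is the group of integer functions on regular rays that depend only on a past of some
finite length, and `λ` is the transfer operator of the shift `σ`, summing over preimages
(`exists_eval_eq_iff`, `eval_lam`).

A conjugacy is a block code, so after a shift that absorbs its memory it acts on rays: there are
maps `F`, `G` commuting with `σ` such that `GF` and `FG` are `σ^n` (`RayConj`). The further shift in
`σ^n F` makes regularity pull back and makes pasts comparable: a past of the image that is longer by
`2n`, together with a code from a finite set, determines the past of the ray (`past_eq`). Hence the
transfer operators of `σ^n F` and `σ^n G` act on `ℤ_{I^t}`, preserve positivity, commute with `λ`,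
and compose to `λ^(3n)`: a shift equivalence of lag `3n` (`exists_isShiftEquiv`).

The rest is formal. A shift equivalence induces isomorphisms on kernels and cokernels of `id - λ`
and on inductive limits. The group `ℤ_I` is `Hom(ℤ_{I^t}, ℤ)` with `M` dual to `λ`
(`toDual_bijective`, `toDual_Mend`), so the dual shift equivalence handles the Bowen–Franks groups.
For the entropies, the same comparison of pasts bounds the vertices and paths of one system by those
of the other, `2n` levels deeper, times a constant. -/

/-- `R` and `S` are a shift equivalence of lag `m` between the endomorphisms `a` and `b`. -/
structure IsShiftEquiv {G : Type*} {H : Type*} [AddCommGroup G] [AddCommGroup H]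
    (a : G →+ G) (b : H →+ H) (m : ℕ) (R : G →+ H) (S : H →+ G) : Prop where
  map_left : ∀ x, R (a x) = b (R x)
  map_right : ∀ y, S (b y) = a (S y)
  right_left : ∀ x, S (R x) = a^[m] x
  left_right : ∀ y, R (S y) = b^[m] y

namespace IsShiftEquiv

variable {G : Type u} {H : Type v} [AddCommGroup G] [AddCommGroup H]
  {a : G →+ G} {b : H →+ H} {m : ℕ} {R : G →+ H} {S : H →+ G}

theorem symm (h : IsShiftEquiv a b m R S) : IsShiftEquiv b a m S R :=
  ⟨h.map_right, h.map_left, h.left_right, h.right_left⟩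

/-- Telescoping: every power of `a` is the identity on the cokernel, so `R` and `S` become mutually
inverse there. -/
theorem iterate_sub_self_mem (a : G →+ G) (m : ℕ) (x : G) :
    a^[m] x - x ∈ (AddMonoidHom.id G - a).range := by
  induction m with
  | zero => simp
  | succ m ih =>
    rw [Function.iterate_succ_apply']
    have h : a (a^[m] x) - a^[m] x ∈ (AddMonoidHom.id G - a).range :=
      ⟨-(a^[m] x), by simp [sub_eq_add_neg, add_comm]⟩
    simpa using add_mem h ih

/-- The map induced by `R` on the cokernels of `id - a` and `id - b`. -/
def cokerMap (h : IsShiftEquiv a b m R S) :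
    G ⧸ (AddMonoidHom.id G - a).range →+ H ⧸ (AddMonoidHom.id H - b).range :=
  QuotientAddGroup.map _ _ R (by
    rintro _ ⟨x, rfl⟩
    exact ⟨R x, by simp [h.map_left]⟩)

theorem cokerMap_cokerMap (h : IsShiftEquiv a b m R S)
    (x : G ⧸ (AddMonoidHom.id G - a).range) : h.symm.cokerMap (h.cokerMap x) = x := by
  obtain ⟨x, rfl⟩ := QuotientAddGroup.mk_surjective x
  change ((S (R x) : G) : G ⧸ (AddMonoidHom.id G - a).range) = x
  rw [h.right_left, eq_comm, QuotientAddGroup.eq, neg_add_eq_sub]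
  exact iterate_sub_self_mem a m x

/-- Shift equivalent endomorphisms have isomorphic cokernels of `id - a` and `id - b`. -/
def cokerEquiv (h : IsShiftEquiv a b m R S) :
    G ⧸ (AddMonoidHom.id G - a).range ≃+ H ⧸ (AddMonoidHom.id H - b).range :=
  { h.cokerMap with
    invFun := h.symm.cokerMap
    left_inv := h.cokerMap_cokerMap
    right_inv := h.symm.cokerMap_cokerMap }

theorem mem_ker_iff {x : G} : x ∈ (AddMonoidHom.id G - a).ker ↔ a x = x := by
  rw [AddMonoidHom.mem_ker, AddMonoidHom.sub_apply, sub_eq_zero, eq_comm]; rfl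

/-- The map induced by `R` on the kernels of `id - a` and `id - b`. -/
def kerMap (h : IsShiftEquiv a b m R S) :
    (AddMonoidHom.id G - a).ker →+ (AddMonoidHom.id H - b).ker :=
  (R.comp (AddSubgroup.subtype _)).codRestrict _ (by
    rintro ⟨x, hx⟩
    rw [mem_ker_iff] at hx ⊢
    change b (R x) = R x
    rw [← h.map_left, hx])

theorem kerMap_kerMap (h : IsShiftEquiv a b m R S) (x : (AddMonoidHom.id G - a).ker) :
    h.symm.kerMap (h.kerMap x) = x := by
  obtain ⟨x, hx⟩ := x
  apply Subtype.ext
  change S (R x) = x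
  rw [h.right_left]
  exact Function.iterate_fixed (mem_ker_iff.1 hx) m

/-- Shift equivalent endomorphisms have isomorphic kernels of `id - a` and `id - b`. -/
def kerEquiv (h : IsShiftEquiv a b m R S) :
    (AddMonoidHom.id G - a).ker ≃+ (AddMonoidHom.id H - b).ker :=
  { h.kerMap with
    invFun := h.symm.kerMap
    left_inv := h.kerMap_kerMap
    right_inv := h.symm.kerMap_kerMap }

/-- The inductive limit `G → G → G → ⋯` of an endomorphism. -/
abbrev Lim (a : G →+ G) : Type u := SeqLimit (G := fun _ => G) (fun _ => a)

/-- The class of `x` at position `k` in the inductive limit of an endomorphism. -/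
abbrev limOf (a : G →+ G) (k : ℕ) : G →+ Lim a := SeqLimit.of (G := fun _ => G) (fun _ => a) k

theorem limOf_iterate (a : G →+ G) (k m : ℕ) (x : G) : limOf a (k + m) (a^[m] x) = limOf a k x := by
  induction m with
  | zero => rfl
  | succ m ih =>
    rw [Function.iterate_succ_apply', ← ih]
    exact SeqLimit.of_step (G := fun _ => G) (fun _ => a) (k + m) _

/-- The map induced by `R` on the inductive limits, followed by `i` steps forward. -/
def limMap (h : IsShiftEquiv a b m R S) (i : ℕ) : Lim a →+ Lim b :=
  SeqLimit.lift (G := fun _ => G) (fun _ => a) (fun k => (limOf b (k + i)).comp R) (by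
    intro k x
    have := limOf_iterate b (k + i) 1 (R x)
    simpa [h.map_left, add_right_comm] using this)

theorem limMap_of (h : IsShiftEquiv a b m R S) (i k : ℕ) (x : G) :
    h.limMap i (limOf a k x) = limOf b (k + i) (R x) :=
  AddCommGroup.DirectLimit.lift_of _ _ _ _ _

/-- The composite `S ∘ R` is `a^m`, which the total advance by `i + j = m` positions cancels in the
limit. -/
theorem limMap_limMap (h : IsShiftEquiv a b m R S) {i j : ℕ} (hij : i + j = m) (x : Lim a) :
    h.symm.limMap j (h.limMap i x) = x := by
  induction x using AddCommGroup.DirectLimit.induction_on with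
  | ih k x =>
    change h.symm.limMap j (h.limMap i (limOf a k x)) = limOf a k x
    rw [limMap_of, limMap_of, h.right_left, add_assoc, hij, limOf_iterate]

/-- Shift equivalent endomorphisms have isomorphic inductive limits. -/
def limEquiv (h : IsShiftEquiv a b m R S) : Lim a ≃+ Lim b :=
  { h.limMap 0 with
    invFun := h.symm.limMap m
    left_inv := h.limMap_limMap (zero_add m)
    right_inv := h.symm.limMap_limMap (add_zero m) }

/-- If `R` and `S` preserve the cones `P` and `Q`, then the isomorphism of the inductive limits
maps the limit cone of `P` onto the limit cone of `Q`. -/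
theorem limEquiv_image (h : IsShiftEquiv a b m R S) {P : Set G} {Q : Set H}
    (hR : ∀ x ∈ P, R x ∈ Q) (hS : ∀ y ∈ Q, S y ∈ P) :
    h.limEquiv '' {z | ∃ (k : ℕ) (y : G), y ∈ P ∧ limOf a k y = z} =
      {z | ∃ (k : ℕ) (y : H), y ∈ Q ∧ limOf b k y = z} := by
  ext z
  constructor
  · rintro ⟨_, ⟨k, y, hy, rfl⟩, rfl⟩
    exact ⟨k, R y, hR y hy, (h.limMap_of 0 k y).symm⟩
  · rintro ⟨k, y, hy, rfl⟩
    -- The preimage is the value of the inverse map, which is `S` followed by `m` steps forward.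
    refine ⟨limOf a (k + m) (S y), ⟨_, _, hS y hy, rfl⟩, ?_⟩
    rw [← h.symm.limMap_of m k y]
    exact h.symm.limMap_limMap (add_zero m) _

/-- The transposed shift equivalence between the dual groups. -/
theorem dual (h : IsShiftEquiv a b m R S) (K : Type*) [AddCommGroup K] :
    IsShiftEquiv (AddMonoidHom.compHom' (P := K) a) (AddMonoidHom.compHom' b) m
      (AddMonoidHom.compHom' S) (AddMonoidHom.compHom' R) where
  map_left f := by ext x; exact congrArg f (h.map_right x).symm
  map_right f := by ext x; exact congrArg f (h.map_left x).symm
  right_left f := by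
    ext x
    have : ∀ m : ℕ, ((AddMonoidHom.compHom' a)^[m] f) x = f (a^[m] x) := by
      intro m
      induction m generalizing x with
      | zero => rfl
      | succ m ih =>
        rw [Function.iterate_succ_apply', Function.iterate_succ_apply, ← ih]; rfl
    rw [this, ← h.right_left]; rfl
  left_right f := by
    ext x
    have : ∀ m : ℕ, ((AddMonoidHom.compHom' b)^[m] f) x = f (b^[m] x) := by
      intro m
      induction m generalizing x with
      | zero => rfl
      | succ m ih =>
        rw [Function.iterate_succ_apply', Function.iterate_succ_apply, ← ih]; rfl
    rw [this, ← h.left_right]; rfl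

/-- Shift equivalence is invariant under isomorphism of the endomorphisms. -/
theorem conj (h : IsShiftEquiv a b m R S) {G' H' : Type*} [AddCommGroup G'] [AddCommGroup H']
    {a' : G' →+ G'} {b' : H' →+ H'} (e : G' ≃+ G) (f : H' ≃+ H)
    (he : ∀ x, e (a' x) = a (e x)) (hf : ∀ y, f (b' y) = b (f y)) :
    IsShiftEquiv a' b' m ((f.symm.toAddMonoidHom.comp R).comp e.toAddMonoidHom)
      ((e.symm.toAddMonoidHom.comp S).comp f.toAddMonoidHom) where
  map_left x := f.injective (by simp [he, hf, h.map_left])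
  map_right y := e.injective (by simp [he, hf, h.map_right])
  right_left x := e.injective (by
    simpa [h.right_left] using ((Function.Semiconj.iterate_right he m).eq x).symm)
  left_right y := f.injective (by
    simpa [h.left_right] using ((Function.Semiconj.iterate_right hf m).eq y).symm)

end IsShiftEquiv

/-! ## The projective limit as a dual group -/

namespace NonnegMatrixSystem

variable (S : NonnegMatrixSystem.{u})

open Matrix

/-- Adjointness of `I` and its transpose: a compatible sequence of vectors pairs compatibly with the
inductive system. -/
theorem ZI_apply_It {x : ∀ l, S.V l → ℤ} (hx : x ∈ S.ZI) (l : ℕ) (w : S.V l → ℤ) :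
    S.It l w ⬝ᵥ x (l + 1) = w ⬝ᵥ x l := by
  rw [← hx l]
  change (S.IZ l).transpose.mulVec w ⬝ᵥ x (l + 1) = _
  rw [Matrix.mulVec_transpose, Matrix.dotProduct_mulVec]

/-- Pairing with a vector, as a homomorphism. -/
def dotHom {ι : Type*} [Fintype ι] (x : ι → ℤ) : (ι → ℤ) →+ ℤ where
  toFun w := w ⬝ᵥ x
  map_zero' := zero_dotProduct x
  map_add' w w' := add_dotProduct w w' x

/-- The functional on the inductive limit given by an element of the projective limit. -/
def toDual (x : S.ZI) : S.ZIt →+ ℤ :=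
  SeqLimit.lift S.It (fun l => dotHom (x.1 l)) (fun l w => S.ZI_apply_It x.2 l w)

theorem toDual_of (x : S.ZI) (l : ℕ) (w : S.V l → ℤ) :
    S.toDual x (SeqLimit.of S.It l w) = w ⬝ᵥ x.1 l :=
  AddCommGroup.DirectLimit.lift_of _ _ _ _ _

theorem hom_ext_ZIt {K : Type*} [AddCommMonoid K] {f g : S.ZIt →+ K}
    (h : ∀ l w, f (SeqLimit.of S.It l w) = g (SeqLimit.of S.It l w)) : f = g :=
  AddCommGroup.DirectLimit.hom_ext _ fun l => AddMonoidHom.ext (h l)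

theorem lam_of (l : ℕ) (w : S.V l → ℤ) :
    S.lam (SeqLimit.of S.It l w) = SeqLimit.of S.It (l + 1) (S.Mt l w) :=
  AddCommGroup.DirectLimit.lift_of _ _ _ _ _

theorem toDual_Mend (x : S.ZI) : S.toDual (S.Mend x) = (S.toDual x).comp S.lam := by
  refine S.hom_ext_ZIt fun l w => ?_
  rw [AddMonoidHom.comp_apply, lam_of, toDual_of, toDual_of]
  change w ⬝ᵥ (S.MZ l).mulVec (x.1 (l + 1)) = (S.MZ l).transpose.mulVec w ⬝ᵥ x.1 (l + 1)
  rw [Matrix.mulVec_transpose, Matrix.dotProduct_mulVec]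

/-- Each `ℤ^{V_l}` is its own dual through the standard basis, and `Hom(-, ℤ)` turns the inductive
limit into the projective one. -/
theorem toDual_bijective : Function.Bijective S.toDual := by
  classical
  constructor
  · intro x y h
    apply Subtype.ext
    funext l i
    have := DFunLike.congr_fun h (SeqLimit.of S.It l (Pi.single i 1))
    simpa [toDual_of] using this
  · intro f
    let x : ∀ l, S.V l → ℤ := fun l i => f (SeqLimit.of S.It l (Pi.single i 1))
    have hf : ∀ l w, f (SeqLimit.of S.It l w) = w ⬝ᵥ x l := by
      intro l w
      conv_lhs => rw [pi_eq_sum_univ' w]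
      rw [map_sum, map_sum]
      refine Finset.sum_congr rfl fun i _ => ?_
      rw [map_zsmul, map_zsmul, smul_eq_mul]
    have hx : x ∈ S.ZI := by
      intro l
      funext i
      have h1 := hf (l + 1) (S.It l (Pi.single i 1))
      rw [SeqLimit.of_step] at h1
      change _ = f (SeqLimit.of S.It l (Pi.single i 1))
      rw [h1]
      change _ = (S.IZ l).transpose.mulVec (Pi.single i 1) ⬝ᵥ x (l + 1)
      rw [Matrix.mulVec_transpose, ← Matrix.dotProduct_mulVec]
      simp
    exact ⟨⟨x, hx⟩, S.hom_ext_ZIt fun l w => by rw [toDual_of, hf]⟩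

/-- The projective limit `ℤ_I` is the dual group of the inductive limit `ℤ_{I^t}`. -/
def dualEquiv : S.ZI ≃+ (S.ZIt →+ ℤ) :=
  AddEquiv.ofBijective
    (AddMonoidHom.mk' S.toDual fun x y => S.hom_ext_ZIt fun l w => by
      rw [AddMonoidHom.add_apply, toDual_of, toDual_of, toDual_of]
      exact dotProduct_add w (x.1 l) (y.1 l))
    S.toDual_bijective

end NonnegMatrixSystem

/-! ## Rays of a subshift -/

section Rays

variable {A : Type u} [TopologicalSpace A]

/-- The right-infinite sequences that occur in points of a subshift. -/
def Ray (X : ZSubshift A) : Type u :=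
  {r : ℕ → A // ∃ x ∈ X.carrier, ∀ i : ℕ, x i = r i}

namespace Ray

variable {X : ZSubshift A}

/-- The ray that starts at the coordinate `i` of a point. -/
def ofPoint {x : ℤ → A} (hx : x ∈ X.carrier) (i : ℤ) : Ray X :=
  ⟨fun j => x (i + j), _, X.mapsTo i hx, fun _ => rfl⟩

theorem ofPoint_apply {x : ℤ → A} (hx : x ∈ X.carrier) (i : ℤ) (j : ℕ) :
    (ofPoint hx i).1 j = x (i + j) := rfl

theorem exists_ofPoint (r : Ray X) : ∃ (x : ℤ → A) (hx : x ∈ X.carrier), ofPoint hx 0 = r := by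
  obtain ⟨r, x, hx, h⟩ := r
  exact ⟨x, hx, Subtype.ext (funext fun i => by rw [ofPoint_apply, zero_add, h])⟩

/-- The shift on rays. -/
def shift (r : Ray X) : Ray X :=
  ⟨fun i => r.1 (i + 1), by
    obtain ⟨r, x, hx, h⟩ := r
    exact ⟨_, X.mapsTo 1 hx, fun i => by simp [← h, add_comm]⟩⟩

theorem shift_iterate_apply (k : ℕ) (r : Ray X) (i : ℕ) : (shift^[k] r).1 i = r.1 (i + k) := by
  induction k generalizing r with
  | zero => rfl
  | succ k ih =>
    rw [Function.iterate_succ_apply, ih]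
    rfl

theorem shift_iterate_ofPoint {x : ℤ → A} (hx : x ∈ X.carrier) (i : ℤ) (k : ℕ) :
    shift^[k] (ofPoint hx i) = ofPoint hx (i + k) := by
  refine Subtype.ext (funext fun j => ?_)
  rw [shift_iterate_apply, ofPoint_apply, ofPoint_apply]
  congr 1
  push_cast
  ring

/-- Points of the subshift are two-sided, so a ray can always be extended to the left. -/
theorem exists_shift_iterate (k : ℕ) (r : Ray X) : ∃ r' : Ray X, shift^[k] r' = r := by
  obtain ⟨x, hx, rfl⟩ := r.exists_ofPoint
  exact ⟨ofPoint hx (-k), by rw [shift_iterate_ofPoint]; simp⟩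

/-! ### Prefixes of rays and the language. -/

/-- The prefix of length `k` of a ray. -/
def pre (k : ℕ) (r : Ray X) : List A := (List.range k).map r.1

@[simp]
theorem length_pre (k : ℕ) (r : Ray X) : (pre k r).length = k := by simp [pre]

theorem pre_eq_pre_iff {k : ℕ} {r r' : Ray X} :
    pre k r = pre k r' ↔ ∀ i < k, r.1 i = r'.1 i := by
  simp [pre, List.map_inj_left]

theorem pre_mono {k k' : ℕ} (h : k ≤ k') {r r' : Ray X} (hr : pre k' r = pre k' r') :
    pre k r = pre k r' :=
  pre_eq_pre_iff.2 fun i hi => pre_eq_pre_iff.1 hr i (hi.trans_le h)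

theorem pre_shift_iterate {l k : ℕ} {r r' : Ray X} (h : pre (l + k) r = pre (l + k) r') :
    pre k (shift^[l] r) = pre k (shift^[l] r') :=
  pre_eq_pre_iff.2 fun i hi => by
    rw [shift_iterate_apply, shift_iterate_apply]
    exact pre_eq_pre_iff.1 h _ (by omega)

theorem pre_add (l k : ℕ) (r : Ray X) : pre (l + k) r = pre l r ++ pre k (shift^[l] r) := by
  unfold pre
  rw [List.range_add, List.map_append, List.map_map]
  congr 1
  refine List.map_congr_left fun i _ => ?_
  rw [shift_iterate_apply, Function.comp_apply, add_comm]

theorem pre_add_eq {l k : ℕ} {r r' : Ray X} (h : pre l r = pre l r')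
    (h' : pre k (shift^[l] r) = pre k (shift^[l] r')) : pre (l + k) r = pre (l + k) r' := by
  rw [pre_add, pre_add, h, h']

theorem eq_of_pre_of_shift {l : ℕ} {r r' : Ray X} (h : pre l r = pre l r')
    (h' : shift^[l] r = shift^[l] r') : r = r' := by
  refine Subtype.ext (funext fun i => ?_)
  have := pre_add_eq (k := i + 1) h (by rw [h'])
  exact pre_eq_pre_iff.1 this i (by omega)

theorem pre_mem_language (k : ℕ) (r : Ray X) : pre k r ∈ language X := by
  obtain ⟨r, x, hx, h⟩ := r
  exact ⟨x, hx, 0, fun j hj => by simp [pre, h]⟩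

theorem exists_pre_of_mem_language {w : List A} (hw : w ∈ language X) :
    ∃ r : Ray X, pre w.length r = w := by
  obtain ⟨x, hx, i, h⟩ := hw
  refine ⟨ofPoint hx i, List.ext_getElem (by simp) fun j _ hj => ?_⟩
  simp [pre, ofPoint_apply, h j hj]

theorem mem_language_of_append {b c : List A} {r : Ray X} {n : ℕ}
    (h : pre n r = b ++ c) : pre b.length r = b ∧ pre c.length (shift^[b.length] r) = c := by
  have hn : n = b.length + c.length := by simpa using congrArg List.length h
  rw [hn, pre_add] at h
  exact List.append_inj h (by simp)

/-- Compactness: an increasing sequence of admissible words is a sequence of prefixes of a ray. -/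
theorem exists_ray_of_chain [Finite A] [DiscreteTopology A] (w : ℕ → List A)
    (hw : ∀ k, w k ∈ language X) (hmono : ∀ k, w k <+: w (k + 1)) :
    ∃ r : Ray X, ∀ k, pre (w k).length r = w k := by
  let C : ℕ → Set (ℤ → A) :=
    fun k => X.carrier ∩ ⋂ j : Fin (w k).length, {x | x (j : ℕ) = (w k)[j]}
  have hC : ∀ k, IsClosed (C k) := fun k =>
    X.isClosed.inter (isClosed_iInter fun j =>
      isClosed_eq (continuous_apply _) continuous_const)
  have hne : (⋂ k, C k).Nonempty := by
    refine IsCompact.nonempty_iInter_of_sequence_nonempty_isCompact_isClosed C ?_ ?_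
      (hC 0).isCompact hC
    · rintro k x ⟨hx, h⟩
      refine ⟨hx, Set.mem_iInter.2 fun j => ?_⟩
      have hlt := j.2.trans_le (hmono k).length_le
      have := Set.mem_iInter.1 h ⟨j, hlt⟩
      change x (j : ℕ) = (w k)[(j : ℕ)]
      rw [(hmono k).getElem j.2]
      exact this
    · intro k
      obtain ⟨x, hx, i, h⟩ := hw k
      refine ⟨_, X.mapsTo i hx, Set.mem_iInter.2 fun j => h j j.2⟩
  obtain ⟨x, hx⟩ := hne
  rw [Set.mem_iInter] at hx
  refine ⟨ofPoint (hx 0).1 0, fun k => List.ext_getElem (by simp) fun j _ hj => ?_⟩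
  have := Set.mem_iInter.1 (hx k).2 ⟨j, hj⟩
  simpa [pre, ofPoint_apply] using this

theorem exists_append_ray [Finite A] [DiscreteTopology A] {b : List A} {r : Ray X}
    (h : ∀ k, b ++ pre k r ∈ language X) :
    ∃ r' : Ray X, pre b.length r' = b ∧ shift^[b.length] r' = r := by
  obtain ⟨r', hr'⟩ := exists_ray_of_chain (fun k => b ++ pre k r) h fun k =>
    ⟨pre 1 (shift^[k] r), by rw [List.append_assoc, ← pre_add]⟩
  have hr : ∀ k, pre b.length r' = b ∧ pre k (shift^[b.length] r') = pre k r := fun k => by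
    simpa using mem_language_of_append (hr' k)
  refine ⟨r', (hr 0).1, Subtype.ext (funext fun i => ?_)⟩
  exact pre_eq_pre_iff.1 (hr (i + 1)).2 i (by omega)

/-! ### Pasts of rays and synchronizing prefixes. -/

/-- The words of length `l` that may precede a ray. -/
def past (l : ℕ) (r : Ray X) : Set (List A) := pre l '' {r' | shift^[l] r' = r}

theorem past_subset_gammaMinus (l k : ℕ) (r : Ray X) : past l r ⊆ gammaMinus X l (pre k r) := by
  rintro _ ⟨r', rfl, rfl⟩
  exact ⟨pre_mem_language _ _, by simp, by rw [← pre_add]; exact pre_mem_language _ _⟩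

/-- A predecessor `b` of a synchronizing prefix may precede every longer prefix too, so by
compactness it may precede the whole ray. -/
theorem past_eq_gammaMinus [Finite A] [DiscreteTopology A] {l k : ℕ} {r : Ray X}
    (h : pre k r ∈ syncWords X l) : past l r = gammaMinus X l (pre k r) := by
  refine (past_subset_gammaMinus l k r).antisymm fun b hb => ?_
  have hl := hb.2.1
  have key : ∀ i, b ++ pre i r ∈ language X := by
    intro i
    -- Synchronization only speaks about continuations of `pre k r`; going out to `k + i` and
    -- truncating covers `i < k` as well.
    have h1 : b ++ pre (k + i) r ∈ language X := by
      rw [pre_add, ← List.append_assoc]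
      exact (h.2 hb).2.2 _ ⟨pre_mem_language _ _, by rw [← pre_add]; exact pre_mem_language _ _⟩
    rw [add_comm, pre_add, ← List.append_assoc] at h1
    exact language_left h1
  obtain ⟨r', h1, h2⟩ := exists_append_ray key
  rw [hl] at h1 h2
  exact ⟨r', h2, h1⟩

/-- The prefix of length `k` of a ray is `l`-synchronizing if and only if all rays with this prefix
have the same past of length `l`. -/
theorem pre_mem_syncWords_iff [Finite A] [DiscreteTopology A] {l k : ℕ} {r : Ray X} :
    pre k r ∈ syncWords X l ↔ ∀ r' : Ray X, pre k r' = pre k r → past l r' = past l r := by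
  constructor
  · intro h r' hr'
    rw [past_eq_gammaMinus h, past_eq_gammaMinus (k := k) (by rwa [hr']), hr']
  · intro h
    refine ⟨pre_mem_language k r, fun b hb => ⟨hb.1, hb.2.1, fun c hc => ?_⟩⟩
    obtain ⟨r1, h1⟩ := exists_pre_of_mem_language hb.2.2
    obtain ⟨h2, h3⟩ := mem_language_of_append h1
    rw [hb.2.1] at h2 h3
    rw [length_pre] at h3
    -- The word `b` moves from the past of the tail of `r1` to that of `r`, and from there to that
    -- of `r2`, which realizes the continuation `c`.
    have hb1 : b ∈ past l r := by
      rw [← h _ h3]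
      exact ⟨r1, rfl, h2⟩
    obtain ⟨r2, h4⟩ := exists_pre_of_mem_language hc.2
    obtain ⟨h5, -⟩ := mem_language_of_append h4
    rw [length_pre] at h5
    rw [← h _ h5] at hb1
    have := (past_subset_gammaMinus l (pre k r ++ c).length r2 hb1).2.2
    rwa [h4, ← List.append_assoc] at this

/-! ### Regular rays. -/

/-- A ray is regular if for every `l` its past of length `l` is locally constant at the ray. -/
def IsRegular (r : Ray X) : Prop :=
  ∀ l, ∃ k, ∀ r' : Ray X, pre k r' = pre k r → past l r' = past l r

theorem IsRegular.exists_mem_syncWords [Finite A] [DiscreteTopology A] {r : Ray X}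
    (hr : IsRegular r) (l : ℕ) : ∃ k, pre k r ∈ syncWords X l := by
  obtain ⟨k, hk⟩ := hr l
  exact ⟨k, pre_mem_syncWords_iff.2 hk⟩

/-- Each letter put in front costs one level of synchronization. -/
theorem append_mem_syncWords {l : ℕ} {w v : List A} (hv : v ∈ syncWords X (l + w.length))
    (h : w ++ v ∈ language X) : w ++ v ∈ syncWords X l := by
  induction w generalizing l with
  | nil => exact hv
  | cons α w ih =>
    have hw : w ++ v ∈ language X := language_right (a := [α]) (by simpa using h)
    have h1 := ih (l := l + 1) (by simpa [add_assoc, add_comm 1] using hv) hw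
    refine cons_mem_syncWords h1 ⟨?_, rfl, by simpa using h⟩
    exact language_left (b := w ++ v) (by simpa using h)

/-- Every admissible word of a λ-synchronizing subshift can be continued by a regular ray. -/
theorem exists_isRegular [Finite A] [DiscreteTopology A] (hX : IsLambdaSynchronizing X)
    {w : List A} (hw : w ∈ language X) :
    ∃ r : Ray X, pre w.length r = w ∧ IsRegular (shift^[w.length] r) := by
  choose! v hv hv' using hX
  -- The word appended at stage `k` is synchronizing at level `k + |W k|`. Prepending `W k` costs
  -- `|W k|` levels, so `W (k + 1)` is still `k`-synchronizing.
  let W : ℕ → List A := fun k =>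
    Nat.rec [] (fun k t => t ++ v (w ++ t) (k + t.length)) k
  have hW : ∀ k, W (k + 1) = W k ++ v (w ++ W k) (k + (W k).length) := fun k => rfl
  have hL : ∀ k, w ++ W k ∈ language X := by
    intro k
    induction k with
    | zero => simpa [W] using hw
    | succ k ih =>
      rw [hW, ← List.append_assoc]
      exact (hv' _ ih _).2
  obtain ⟨r, hr⟩ := exists_ray_of_chain (fun k => w ++ W k) hL fun k =>
    ⟨v (w ++ W k) (k + (W k).length), by rw [hW, List.append_assoc]⟩
  have hr' := fun k => mem_language_of_append (hr k)
  refine ⟨r, (hr' 0).1, fun l => ⟨(W (l + 1)).length, pre_mem_syncWords_iff.1 ?_⟩⟩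
  rw [(hr' (l + 1)).2, hW]
  refine append_mem_syncWords (hv _ (hL l) _) ?_
  rw [← hW]
  exact language_right (hL (l + 1))

end Ray

end Rays

/-! ## Eventual conjugacies of ray spaces -/

open Ray

variable {A : Type u} [TopologicalSpace A] {B : Type v} [TopologicalSpace B]

/-- A pair of sliding block codes between the ray spaces that commute with the shifts, look
ahead at most `n` coordinates, and are inverse to each other up to the `n`-th power of the
shift. -/
structure RayConj (X : ZSubshift A) (Y : ZSubshift B) (n : ℕ) where
  F : Ray X → Ray Y
  G : Ray Y → Ray X
  F_shift : ∀ x, F (shift x) = shift (F x)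
  G_shift : ∀ y, G (shift y) = shift (G y)
  G_F : ∀ x, G (F x) = shift^[n] x
  F_G : ∀ y, F (G y) = shift^[n] y
  F_local : ∀ k x x', pre (k + n) x = pre (k + n) x' → pre k (F x) = pre k (F x')
  G_local : ∀ k y y', pre (k + n) y = pre (k + n) y' → pre k (G y) = pre k (G y')

namespace RayConj

/-- The identity. -/
def refl (X : ZSubshift A) : RayConj X X 0 :=
  ⟨id, id, fun _ => rfl, fun _ => rfl, fun _ => rfl, fun _ => rfl, fun _ _ _ h => h,
    fun _ _ _ h => h⟩

variable {X : ZSubshift A} {Y : ZSubshift B} {n : ℕ} (e : RayConj X Y n)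

/-- The inverse. -/
def symm : RayConj Y X n :=
  ⟨e.G, e.F, e.G_shift, e.F_shift, e.F_G, e.G_F, e.G_local, e.F_local⟩

theorem F_shift_iterate (k : ℕ) (x : Ray X) : e.F (shift^[k] x) = shift^[k] (e.F x) :=
  (Function.Semiconj.iterate_right (f := e.F) e.F_shift k).eq x

theorem G_shift_iterate (k : ℕ) (y : Ray Y) : e.G (shift^[k] y) = shift^[k] (e.G y) :=
  e.symm.F_shift_iterate k y

/-- The code `x ↦ shift^[j] (F x)`. -/
def map (j : ℕ) (x : Ray X) : Ray Y := shift^[j] (e.F x)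

/-- The words that determine a ray in a given fibre of `e.map j`. -/
def code (j : ℕ) (x : Ray X) : List B × List A := (pre j (e.F x), pre n x)

/-- The code and the image give all of `F x`, hence `G (F x) = shift^[n] x`; the first `n` letters
of `x` are in the code. -/
theorem eq_of_code {j : ℕ} {x x' : Ray X} (h : e.map j x = e.map j x')
    (hc : e.code j x = e.code j x') : x = x' := by
  obtain ⟨h1, h2⟩ := Prod.ext_iff.1 hc
  refine eq_of_pre_of_shift h2 ?_
  rw [← e.G_F, ← e.G_F, eq_of_pre_of_shift h1 h]

variable {e} {j : ℕ}

/-- Every ray `x` has a preimage `y` under `G` such that the prefix of `y` of length `l + n + j`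
determines the code of `shift^[l] x` and the prefix of length `l` of `x`. -/
theorem exists_G_eq (l j : ℕ) (x : Ray X) :
    ∃ y, e.G y = x ∧ shift^[l + n + j] y = e.map j (shift^[l] x) := by
  obtain ⟨x', rfl⟩ := exists_shift_iterate n x
  refine ⟨e.F x', e.G_F x', ?_⟩
  unfold map
  rw [e.F_shift_iterate, e.F_shift_iterate, ← Function.iterate_add_apply,
    ← Function.iterate_add_apply]
  congr 1
  omega

theorem map_shift_G (l j : ℕ) (y : Ray Y) :
    e.map j (shift^[l] (e.G y)) = shift^[l + n + j] y := by
  unfold map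
  rw [e.F_shift_iterate, e.F_G, ← Function.iterate_add_apply, ← Function.iterate_add_apply]
  congr 1
  omega

/-- The prefix of length `n` of `shift^[l] (e.G y)` depends on `l + n + n` letters of `y`; this is
where `n ≤ j` enters. -/
theorem code_G_eq (hj : n ≤ j) {l : ℕ} {y y' : Ray Y}
    (h : pre (l + n + j) y = pre (l + n + j) y') :
    e.code j (shift^[l] (e.G y)) = e.code j (shift^[l] (e.G y')) := by
  refine Prod.ext ?_ ?_
  · change pre j (e.F _) = pre j (e.F _)
    rw [e.F_shift_iterate, e.F_shift_iterate, e.F_G, e.F_G, ← Function.iterate_add_apply,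
      ← Function.iterate_add_apply]
    exact pre_shift_iterate h
  · exact pre_shift_iterate (e.G_local (l + n) y y' (pre_mono (by omega) h))

theorem pre_G_eq {l : ℕ} {y y' : Ray Y}
    (h : pre (l + n + j) y = pre (l + n + j) y') : pre l (e.G y) = pre l (e.G y') :=
  e.G_local l y y' (pre_mono (by omega) h)

/-- Lift `x` through `G` to a ray `z` that ends in `y`. Its prefix of length `l + n + j` may also
precede `y'`; exchange the tail and apply `G` again. -/
theorem exists_transfer (hj : n ≤ j) {l : ℕ} {y y' : Ray Y}
    (h : past (l + n + j) y ⊆ past (l + n + j) y') {x : Ray X}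
    (hx : e.map j (shift^[l] x) = y) :
    ∃ x', e.map j (shift^[l] x') = y' ∧
      e.code j (shift^[l] x') = e.code j (shift^[l] x) ∧ pre l x' = pre l x := by
  obtain ⟨z, rfl, hz⟩ := e.exists_G_eq l j x
  rw [hx] at hz
  obtain ⟨z', hz', hzz⟩ := h ⟨z, hz, rfl⟩
  exact ⟨e.G z', by rw [map_shift_G]; exact hz', code_G_eq hj hzz, pre_G_eq hzz⟩

/-- A transferred ray lies over a ray with the image and the code of `x'`, which by `eq_of_code` is
`x'` itself. -/
theorem past_subset (hj : n ≤ j) {l : ℕ} {x x' : Ray X}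
    (h : past (l + n + j) (e.map j x) ⊆ past (l + n + j) (e.map j x'))
    (hc : e.code j x = e.code j x') : past l x ⊆ past l x' := by
  rintro _ ⟨z, rfl, rfl⟩
  obtain ⟨z', h1, h2, h3⟩ := exists_transfer hj h rfl
  exact ⟨z', e.eq_of_code h1 (h2.trans hc), h3⟩

theorem past_eq (hj : n ≤ j) {l : ℕ} {x x' : Ray X}
    (h : past (l + n + j) (e.map j x) = past (l + n + j) (e.map j x'))
    (hc : e.code j x = e.code j x') : past l x = past l x' :=
  (past_subset hj h.subset hc).antisymm (past_subset hj h.superset hc.symm)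

/-- Two rays with the same past have matching fibres. -/
theorem exists_matching (hj : n ≤ j) {l : ℕ} {y y' : Ray Y}
    (h : past (l + n + j) y = past (l + n + j) y') {x : Ray X} (hx : e.map j x = y) :
    ∃ x', e.map j x' = y' ∧ e.code j x' = e.code j x ∧ past l x' = past l x := by
  obtain ⟨z, rfl⟩ := exists_shift_iterate l x
  obtain ⟨z', h1, h2, -⟩ := exists_transfer hj h.subset hx
  exact ⟨_, h1, h2, past_eq hj (by rw [h1, hx, h]) h2⟩

theorem isRegular_of_map (hj : n ≤ j) {x : Ray X} (hx : IsRegular (e.map j x)) :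
    IsRegular x := by
  intro l
  obtain ⟨k, hk⟩ := hx (l + n + j)
  -- `F` uses up `n` of these letters and the shift `j`, which leaves `k` letters of the image; the
  -- codes agree as well.
  refine ⟨j + k + n, fun x' hx' => ?_⟩
  have hF := e.F_local _ _ _ hx'
  refine past_eq hj (hk _ (pre_shift_iterate hF)) (Prod.ext ?_ ?_)
  · exact pre_mono (by omega) hF
  · exact pre_mono (by omega) hx'

theorem finite_fibre [Finite A] [Finite B] (y : Ray Y) : {x | e.map j x = y}.Finite := by
  refine Set.Finite.of_finite_image (f := e.code j) ?_ fun x hx x' hx' hc =>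
    e.eq_of_code (hx.trans hx'.symm) hc
  refine ((List.finite_length_eq B j).prod (List.finite_length_eq A n)).subset ?_
  rintro _ ⟨x, -, rfl⟩
  exact ⟨length_pre _ _, length_pre _ _⟩

end RayConj

/-! ## Vertices and edges of the λ-graph system in terms of regular rays -/

section RegularRays

variable {A : Type u} [TopologicalSpace A]

/-- The regular rays of a subshift. -/
abbrev Reg (X : ZSubshift A) : Type u := {r : Ray X // IsRegular r}

variable {X : ZSubshift A}

/-- The shift is `map 1` of the identity conjugacy, for which `n = 0`. -/
theorem Ray.IsRegular.of_shift {r : Ray X} (h : IsRegular (shift r)) : IsRegular r :=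
  RayConj.isRegular_of_map (e := RayConj.refl X) (j := 1) (Nat.zero_le 1) h

theorem Ray.IsRegular.of_shift_iterate {r : Ray X} {k : ℕ} (h : IsRegular (shift^[k] r)) :
    IsRegular r :=
  RayConj.isRegular_of_map (e := RayConj.refl X) (j := k) (Nat.zero_le k) h

namespace Reg

variable [Finite A] [DiscreteTopology A]

/-- The vertex at level `l` given by a regular ray. -/
def vtx (l : ℕ) (r : Reg X) : Vertex X l :=
  vertexMk ⟨_, (r.2.exists_mem_syncWords l).choose_spec⟩

/-- Any synchronizing prefix may represent the vertex, since its predecessor set is the past of the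
ray. -/
theorem vtx_eq_mk {l : ℕ} {r : Reg X} {w : List A} (hw : w ∈ syncWords X l)
    (h : pre w.length r.1 = w) : vtx l r = vertexMk ⟨w, hw⟩ := by
  refine vertexMk_eq.2 ?_
  change gammaMinus X l (pre (r.2.exists_mem_syncWords l).choose r.1) = gammaMinus X l w
  rw [← past_eq_gammaMinus (r.2.exists_mem_syncWords l).choose_spec, ← h,
    past_eq_gammaMinus (by rwa [h])]

theorem vtx_eq_iff {l : ℕ} {r r' : Reg X} : vtx l r = vtx l r' ↔ past l r.1 = past l r'.1 := by
  rw [past_eq_gammaMinus (r.2.exists_mem_syncWords l).choose_spec,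
    past_eq_gammaMinus (r'.2.exists_mem_syncWords l).choose_spec]
  exact vertexMk_eq

theorem exists_pre_eq (hX : IsLambdaSynchronizing X) {w : List A} (hw : w ∈ language X) :
    ∃ r : Reg X, pre w.length r.1 = w := by
  obtain ⟨r, h1, h2⟩ := exists_isRegular hX hw
  exact ⟨⟨r, h2.of_shift_iterate⟩, h1⟩

theorem vtx_surjective (hX : IsLambdaSynchronizing X) (l : ℕ) :
    Function.Surjective (vtx (X := X) l) := by
  intro v
  obtain ⟨μ, rfl⟩ := vertexMk_surjective v
  obtain ⟨r, hr⟩ := exists_pre_eq hX μ.2.1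
  exact ⟨r, vtx_eq_mk μ.2 hr⟩

theorem vertexIota_vtx (l : ℕ) (r : Reg X) : vertexIota (vtx (l + 1) r) = vtx l r := by
  have h := (r.2.exists_mem_syncWords (l + 1)).choose_spec
  exact (vtx_eq_mk (syncWords_succ h) (by rw [length_pre])).symm

theorem exists_edge (l : ℕ) {r' r : Reg X} (h : shift r'.1 = r.1) :
    ∃ e : Edge X l, e.1 = (vtx l r', r'.1.1 0, vtx (l + 1) r) := by
  obtain ⟨k, hk⟩ := r.2.exists_mem_syncWords (l + 1)
  have hpre : pre (1 + k) r'.1 = [r'.1.1 0] ++ pre k r.1 := by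
    rw [pre_add, ← h]; rfl
  have hα : [r'.1.1 0] ∈ gammaMinus X 1 (pre k r.1) :=
    past_subset_gammaMinus 1 k r.1 ⟨r'.1, h, rfl⟩
  refine ⟨⟨_, ⟨_, hk⟩, hα, vtx_eq_mk _ ?_, vtx_eq_mk _ ?_⟩, rfl⟩
  · rw [List.length_cons, length_pre, add_comm]; exact hpre
  · rw [length_pre]

theorem exists_of_edge {l : ℕ} {r : Reg X} (e : Edge X l) (he : e.1.2.2 = vtx (l + 1) r) :
    ∃ r' : Reg X, shift r'.1 = r.1 ∧ e.1 = (vtx l r', r'.1.1 0, vtx (l + 1) r) := by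
  obtain ⟨⟨u, α, v⟩, he'⟩ := e
  dsimp only at he
  subst he
  obtain ⟨hα, hu⟩ := (edge_iff _).1 he'
  have hk := (r.2.exists_mem_syncWords (l + 1)).choose_spec
  -- Extend the label to a predecessor `bα` of length `l + 1`. It lies in the past of `r`, and
  -- dropping `b` from a ray that realizes it leaves the required preimage.
  obtain ⟨b, hb⟩ := (cons_mem_gammaMinus_iff (l := l)).1 hα
  rw [mem_gammaMinus_cons, ← past_eq_gammaMinus hk] at hb
  obtain ⟨r1, h1, h2⟩ := hb
  have h3 : shift (shift^[l] r1) = r.1 := 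
    (Function.iterate_succ_apply' shift l r1).symm.trans h1
  rw [pre_add] at h2
  have h4 : (shift^[l] r1).1 0 = α := by
    have := (List.append_inj' h2 (by simp)).2
    simpa [pre] using this
  refine ⟨⟨shift^[l] r1, .of_shift (by rw [h3]; exact r.2)⟩, h3, Prod.ext ?_ (Prod.ext h4.symm rfl)⟩
  refine hu.trans (vtx_eq_mk (cons_mem_syncWords hk hα) ?_).symm
  rw [List.length_cons, add_comm, pre_add]
  simp only [length_pre, Function.iterate_one]
  rw [h3, ← h4]
  rfl

end Reg

end RegularRays

/-! ## Transfer operators -/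

namespace RayConj

variable {A : Type u} [TopologicalSpace A] [Finite A] {B : Type v} [TopologicalSpace B] [Finite B]
  {X : ZSubshift A} {Y : ZSubshift B} {n : ℕ}

theorem finite_fibre_reg (e : RayConj X Y n) (j : ℕ) (y : Ray Y) :
    {x : Reg X | e.map j x.1 = y}.Finite :=
  (e.finite_fibre (j := j) y).preimage Subtype.val_injective.injOn

/-- Summation over the fibres of `e.map j`. -/
def transfer (e : RayConj X Y n) (j : ℕ) : (Reg X → ℤ) →+ (Reg Y → ℤ) where
  toFun f y := ∑ᶠ x ∈ {x : Reg X | e.map j x.1 = y.1}, f x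
  map_zero' := by ext y; simp
  map_add' f g := by
    ext y
    exact finsum_mem_add_distrib (e.finite_fibre_reg j y.1)

theorem transfer_apply (e : RayConj X Y n) (j : ℕ) (f : Reg X → ℤ) (y : Reg Y) :
    e.transfer j f y = ∑ᶠ x ∈ {x : Reg X | e.map j x.1 = y.1}, f x := rfl

theorem transfer_nonneg (e : RayConj X Y n) (j : ℕ) {f : Reg X → ℤ} (hf : ∀ x, 0 ≤ f x)
    (y : Reg Y) : 0 ≤ e.transfer j f y :=
  finsum_nonneg fun x => finsum_nonneg fun _ => hf x

/-- The fibre of a composite is the disjoint union of fibres over the intermediate rays. These rays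
are regular because regularity pulls back along `e'.map j'`, which needs `n' ≤ j'`. -/
theorem transfer_transfer {C : Type*} [TopologicalSpace C] [Finite C] {Z : ZSubshift C}
    {n' n'' : ℕ} (e : RayConj X Y n) (e' : RayConj Y Z n') (e'' : RayConj X Z n'') {j j' k : ℕ}
    (hj' : n' ≤ j') (h : ∀ x, e'.map j' (e.map j x) = e''.map k x) (f : Reg X → ℤ) :
    e'.transfer j' (e.transfer j f) = e''.transfer k f := by
  funext z
  have : {x : Reg X | e''.map k x.1 = z.1} =
      ⋃ y ∈ {y : Reg Y | e'.map j' y.1 = z.1}, {x : Reg X | e.map j x.1 = y.1} := by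
    ext x
    simp only [Set.mem_ofPred_eq, Set.mem_iUnion, exists_prop]
    constructor
    · intro hx
      rw [← h] at hx
      exact ⟨⟨e.map j x.1, isRegular_of_map hj' (by rw [hx]; exact z.2)⟩, hx, rfl⟩
    · rintro ⟨y, hy, hxy⟩
      rw [← h, hxy, hy]
  rw [transfer_apply, transfer_apply, this, finsum_mem_biUnion]
  · rfl
  · intro y _ y' _ hne
    refine Set.disjoint_left.2 fun x hx hx' => hne (Subtype.ext ?_)
    exact (Eq.symm hx).trans hx'
  · exact e'.finite_fibre_reg j' z.1
  · exact fun y _ => e.finite_fibre_reg j y.1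

/-- Matching rays of equal code is a bijection between the two fibres that preserves pasts of length
`l`, so the sums agree term by term. -/
theorem transfer_eq_of_past_eq (e : RayConj X Y n) {j l : ℕ} (hj : n ≤ j) {f : Reg X → ℤ}
    (hf : ∀ x x' : Reg X, past l x.1 = past l x'.1 → f x = f x') {y y' : Reg Y}
    (h : past (l + n + j) y.1 = past (l + n + j) y'.1) :
    e.transfer j f y = e.transfer j f y' := by
  -- Kept general in `y` and `y'`, since surjectivity of the matching uses it with the roles
  -- exchanged.
  have key : ∀ {y y' : Reg Y}, past (l + n + j) y.1 = past (l + n + j) y'.1 →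
      ∀ x ∈ {x : Reg X | e.map j x.1 = y.1}, ∃ x' : Reg X, e.map j x'.1 = y'.1 ∧
        e.code j x'.1 = e.code j x.1 ∧ past l x'.1 = past l x.1 := by
    intro y y' h x hx
    obtain ⟨x', h1, h2, h3⟩ := exists_matching hj h hx
    exact ⟨⟨x', isRegular_of_map hj (by rw [h1]; exact y'.2)⟩, h1, h2, h3⟩
  choose! m hm1 hm2 hm3 using key h
  refine finsum_mem_eq_of_bijOn m ⟨hm1, ?_, ?_⟩ fun x hx => hf _ _ (hm3 x hx).symm
  · intro x hx x' hx' hxx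
    refine Subtype.ext (e.eq_of_code (j := j) (hx.trans (Eq.symm hx')) ?_)
    rw [← hm2 x hx, ← hm2 x' hx', hxx]
  · intro x' hx'
    obtain ⟨x, h1, h2, -⟩ := key h.symm x' hx'
    refine ⟨x, h1, Subtype.ext (e.eq_of_code (j := j) ((hm1 x h1).trans (Eq.symm hx')) ?_)⟩
    rw [hm2 x h1, h2]

end RayConj

/-! ## The group `ℤ_{I^t}` as a group of functions on regular rays -/

theorem NonnegMatrixSystem.exists_of (S : NonnegMatrixSystem.{u}) (z : S.ZIt) :
    ∃ l x, SeqLimit.of S.It l x = z :=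
  AddCommGroup.DirectLimit.induction_on z fun l x => ⟨l, x, rfl⟩

namespace LambdaGraphSystem

variable {A : Type u} (L : LambdaGraphSystem A)

theorem It_apply (l : ℕ) (x : L.V l → ℤ) (v : L.V (l + 1)) :
    L.matrixSystem.It l x v = x (L.iota v) := by
  have := L.finiteV l
  let _ := Fintype.ofFinite (L.V l)
  change ∑ u, ((L.iotaEntry l u v : ℕ) : ℤ) * x u = _
  rw [Finset.sum_eq_single (L.iota v)]
  · simp [iotaEntry]
  · intro b _ hb
    simp [iotaEntry, hb.symm]
  · simp

theorem Mt_apply (l : ℕ) (x : L.V l → ℤ) (v : L.V (l + 1)) :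
    L.matrixSystem.Mt l x v = ∑ᶠ e ∈ {e : L.E l | L.t e = v}, x (L.s e) := by
  classical
  have := L.finiteV l
  have := L.finiteE l
  let _ := Fintype.ofFinite (L.V l)
  let _ := Fintype.ofFinite (L.E l)
  change ∑ u, ((L.edgeCount l u v : ℕ) : ℤ) * x u = _
  rw [finsum_mem_eq_finite_toFinset_sum _ (Set.toFinite _),
    ← Finset.sum_fiberwise (g := fun e => L.s e)]
  refine Finset.sum_congr rfl fun u _ => ?_
  rw [Finset.sum_congr rfl (g := fun _ => x u) (by
    intro e he; rw [(Finset.mem_filter.1 he).2]), Finset.sum_const, nsmul_eq_mul]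
  congr 2
  rw [edgeCount, Nat.card_eq_fintype_card, Fintype.card_subtype]
  congr 1
  ext e
  simp [and_comm]

end LambdaGraphSystem

section Functions

variable {A : Type u} [TopologicalSpace A] [Finite A] [DiscreteTopology A]
  (X : ZSubshift A) (hX : IsLambdaSynchronizing X)

/-- Composition with the map from regular rays to vertices. -/
def evalLevel (l : ℕ) : ((lambdaMatrixSystem X hX).V l → ℤ) →+ (Reg X → ℤ) where
  toFun x r := x (Reg.vtx l r)
  map_zero' := rfl
  map_add' _ _ := rfl

/-- The elements of `ℤ_{I^t}` as functions on regular rays. -/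
def eval : (lambdaMatrixSystem X hX).ZIt →+ (Reg X → ℤ) :=
  SeqLimit.lift _ (evalLevel X hX) (by
    intro l x
    funext r
    refine ((lambdaSyncSystem X hX).It_apply l x (Reg.vtx (l + 1) r)).trans ?_
    exact congrArg x (Reg.vertexIota_vtx l r))

theorem eval_of (l : ℕ) (x : (lambdaMatrixSystem X hX).V l → ℤ) (r : Reg X) :
    eval X hX (SeqLimit.of _ l x) r = x (Reg.vtx l r) :=
  congrFun (AddCommGroup.DirectLimit.lift_of _ _ _ _ _) r

theorem eval_injective : Function.Injective (eval X hX) := by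
  rw [injective_iff_map_eq_zero]
  intro z hz
  obtain ⟨l, x, rfl⟩ := NonnegMatrixSystem.exists_of _ z
  have : x = 0 := by
    funext v
    obtain ⟨r, rfl⟩ := Reg.vtx_surjective hX l v
    exact (eval_of X hX l x r).symm.trans (congrFun hz r)
  rw [this, map_zero]

/-- A function of the past of length `l` is a function on the vertices of level `l`, and every
vertex comes from a regular ray. -/
theorem exists_eval_eq_iff {f : Reg X → ℤ} : (∃ z, eval X hX z = f) ↔
    ∃ l, ∀ r r' : Reg X, past l r.1 = past l r'.1 → f r = f r' := by
  constructor
  · rintro ⟨z, rfl⟩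
    obtain ⟨l, x, rfl⟩ := NonnegMatrixSystem.exists_of _ z
    exact ⟨l, fun r r' h => by rw [eval_of, eval_of, Reg.vtx_eq_iff.2 h]⟩
  · rintro ⟨l, hl⟩
    choose s hs using Reg.vtx_surjective (X := X) hX l
    refine ⟨SeqLimit.of _ l fun v => f (s v), funext fun r => ?_⟩
    rw [eval_of]
    exact hl _ _ (Reg.vtx_eq_iff.1 (hs _))

theorem mem_ZItPos_iff {z : (lambdaMatrixSystem X hX).ZIt} :
    z ∈ (lambdaMatrixSystem X hX).ZItPos ↔ ∀ r, 0 ≤ eval X hX z r := by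
  constructor
  · rintro ⟨l, x, hx, rfl⟩ r
    rw [eval_of]
    exact hx _
  · intro h
    obtain ⟨l, x, rfl⟩ := NonnegMatrixSystem.exists_of _ z
    refine ⟨l, x, fun v => ?_, rfl⟩
    obtain ⟨r, rfl⟩ := Reg.vtx_surjective hX l v
    exact (h r).trans_eq (eval_of X hX l x r)

/-- The endomorphism `λ` of `ℤ_{I^t}` is the transfer operator of the shift. -/
theorem eval_lam (z : (lambdaMatrixSystem X hX).ZIt) :
    eval X hX ((lambdaMatrixSystem X hX).lam z) =
      (RayConj.refl X).transfer 1 (eval X hX z) := by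
  obtain ⟨l, x, rfl⟩ := NonnegMatrixSystem.exists_of _ z
  funext r
  rw [NonnegMatrixSystem.lam_of, eval_of, RayConj.transfer_apply]
  refine ((lambdaSyncSystem X hX).Mt_apply l x (Reg.vtx (l + 1) r)).trans ?_
  have : Nonempty (Reg X) := ⟨r⟩
  -- Edges into the vertex of `r` correspond bijectively to the shift preimages of `r`, the label
  -- being the first letter of the preimage.
  have key : ∀ e ∈ {e : Edge X l | e.1.2.2 = Reg.vtx (l + 1) r}, ∃ r' : Reg X,
      shift r'.1 = r.1 ∧ e.1 = (Reg.vtx l r', r'.1.1 0, Reg.vtx (l + 1) r) :=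
    fun e he => Reg.exists_of_edge e he
  choose! m hm hm' using key
  refine finsum_mem_eq_of_bijOn (s := {e : Edge X l | e.1.2.2 = Reg.vtx (l + 1) r})
    (t := {r' : Reg X | (RayConj.refl X).map 1 r'.1 = r.1}) (f := fun e => x e.1.1)
    m ⟨hm, ?_, ?_⟩ fun e he => ?_
  · intro e he e' he' h
    exact Subtype.ext ((hm' e he).trans (by rw [h, hm' e' he']))
  · intro r' h
    obtain ⟨e, he⟩ := Reg.exists_edge l h
    have he' : e ∈ {e : Edge X l | e.1.2.2 = Reg.vtx (l + 1) r} := by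
      rw [Set.mem_ofPred_eq, he]
    have h0 : (m e).1.1 0 = r'.1.1 0 :=
      congrArg (fun p => p.2.1) ((hm' e he').symm.trans he)
    refine ⟨e, he', Subtype.ext (eq_of_pre_of_shift (l := 1) ?_ ((hm e he').trans (Eq.symm h)))⟩
    simp [pre, h0]
  · exact (congrArg (fun p => x p.1) (hm' e he)).trans (eval_of X hX l x _).symm

theorem eval_lam_iterate (m : ℕ) (z : (lambdaMatrixSystem X hX).ZIt) :
    eval X hX ((lambdaMatrixSystem X hX).lam^[m] z) =
      (RayConj.refl X).transfer m (eval X hX z) := by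
  induction m with
  | zero =>
    funext r
    have : {x : Reg X | (RayConj.refl X).map 0 x.1 = r.1} = {r} := by
      ext x; exact Subtype.ext_iff.symm
    rw [RayConj.transfer_apply, this, finsum_mem_singleton]
    rfl
  | succ m ih =>
    rw [Function.iterate_succ_apply', eval_lam, ih]
    exact RayConj.transfer_transfer (RayConj.refl X) (RayConj.refl X) (RayConj.refl X)
      (Nat.zero_le 1) (fun x => (Function.iterate_succ_apply' shift m x).symm) _

end Functions

/-! ## Shift equivalence of the matrix systems -/

section ShiftEquivalence

variable {A : Type u} [TopologicalSpace A] [Finite A] [DiscreteTopology A]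
  {B : Type v} [TopologicalSpace B] [Finite B] [DiscreteTopology B]
  {X : ZSubshift A} {Y : ZSubshift B} (hX : IsLambdaSynchronizing X)
  (hY : IsLambdaSynchronizing Y) {n : ℕ}

/-- Transfer along `e.map n` turns functions of the past of length `l` into functions of the past of
length `l + n + n`, so it stays in the image of `eval`. -/
theorem RayConj.exists_hom (e : RayConj X Y n) :
    ∃ R : (lambdaMatrixSystem X hX).ZIt →+ (lambdaMatrixSystem Y hY).ZIt,
      ∀ z, eval Y hY (R z) = e.transfer n (eval X hX z) := by
  have h : ∀ z, ∃ w, eval Y hY w = e.transfer n (eval X hX z) := by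
    intro z
    obtain ⟨l, hl⟩ := (exists_eval_eq_iff X hX).1 ⟨z, rfl⟩
    exact (exists_eval_eq_iff Y hY).2 ⟨_, fun r r' => e.transfer_eq_of_past_eq le_rfl hl⟩
  choose R hR using h
  exact ⟨AddMonoidHom.mk' R fun z w => eval_injective Y hY (by simp only [map_add, hR]), hR⟩

/-- Since `F` commutes with the shift, both sides are transfer along `e.map (n + 1)`. -/
theorem RayConj.hom_lam (e : RayConj X Y n)
    {R : (lambdaMatrixSystem X hX).ZIt →+ (lambdaMatrixSystem Y hY).ZIt}
    (hR : ∀ z, eval Y hY (R z) = e.transfer n (eval X hX z)) (z) :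
    R ((lambdaMatrixSystem X hX).lam z) = (lambdaMatrixSystem Y hY).lam (R z) := by
  apply eval_injective Y hY
  rw [hR, eval_lam, eval_lam, hR, RayConj.transfer_transfer (k := n + 1) _ _ e le_rfl,
    RayConj.transfer_transfer (k := n + 1) _ _ e (Nat.zero_le 1)]
  · intro x
    exact (Function.iterate_succ_apply' shift n _).symm
  · intro x
    change shift^[n] (e.F (shift x)) = _
    rw [e.F_shift, ← Function.iterate_succ_apply]
    rfl

/-- The maps `shift^[n] ∘ F` and `shift^[n] ∘ G` contribute `n` shifts each, and `G ∘ F` another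
`n`. -/
theorem RayConj.hom_hom (e : RayConj X Y n)
    {R : (lambdaMatrixSystem X hX).ZIt →+ (lambdaMatrixSystem Y hY).ZIt}
    (hR : ∀ z, eval Y hY (R z) = e.transfer n (eval X hX z))
    {S : (lambdaMatrixSystem Y hY).ZIt →+ (lambdaMatrixSystem X hX).ZIt}
    (hS : ∀ z, eval X hX (S z) = e.symm.transfer n (eval Y hY z)) (z) :
    S (R z) = (lambdaMatrixSystem X hX).lam^[n + n + n] z := by
  apply eval_injective X hX
  rw [hS, hR, eval_lam_iterate]
  refine RayConj.transfer_transfer _ _ _ le_rfl (fun x => ?_) _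
  change shift^[n] (e.G (shift^[n] (e.F x))) = shift^[n + n + n] x
  rw [e.G_shift_iterate, e.G_F, ← Function.iterate_add_apply, ← Function.iterate_add_apply,
    add_assoc]

/-- The endomorphisms `λ` of subshifts with eventually conjugate ray spaces are shift equivalent
by positive homomorphisms. -/
theorem RayConj.exists_isShiftEquiv (e : RayConj X Y n) :
    ∃ (R : (lambdaMatrixSystem X hX).ZIt →+ (lambdaMatrixSystem Y hY).ZIt)
      (S : (lambdaMatrixSystem Y hY).ZIt →+ (lambdaMatrixSystem X hX).ZIt),
      IsShiftEquiv (lambdaMatrixSystem X hX).lam (lambdaMatrixSystem Y hY).lam (n + n + n) R S ∧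
      (∀ z ∈ (lambdaMatrixSystem X hX).ZItPos, R z ∈ (lambdaMatrixSystem Y hY).ZItPos) ∧
      (∀ z ∈ (lambdaMatrixSystem Y hY).ZItPos, S z ∈ (lambdaMatrixSystem X hX).ZItPos) := by
  obtain ⟨R, hR⟩ := e.exists_hom hX hY
  obtain ⟨S, hS⟩ := e.symm.exists_hom hY hX
  refine ⟨R, S, ⟨e.hom_lam hX hY hR, e.symm.hom_lam hY hX hS, e.hom_hom hX hY hR hS,
    e.symm.hom_hom hY hX hS hR⟩, fun z hz => ?_, fun z hz => ?_⟩
  · rw [mem_ZItPos_iff] at hz ⊢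
    rw [hR]
    exact e.transfer_nonneg n hz
  · rw [mem_ZItPos_iff] at hz ⊢
    rw [hS]
    exact e.symm.transfer_nonneg n hz

end ShiftEquivalence

/-! ## Conjugacies are sliding block codes -/

section BlockCode

variable {A : Type u} [TopologicalSpace A] {B : Type v} [TopologicalSpace B]
  {X : ZSubshift A} {Y : ZSubshift B}

/-- The map `φ` is a sliding block code with memory and anticipation `m`. -/
def IsBlockCode (φ : X.carrier → Y.carrier) (m : ℕ) : Prop :=
  ∀ (x x' : X.carrier) (i i' : ℤ), (∀ j : ℤ, |j| ≤ m → x.1 (i + j) = x'.1 (i' + j)) →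
    (φ x).1 i = (φ x').1 i'

theorem IsBlockCode.mono {φ : X.carrier → Y.carrier} {m m' : ℕ} (h : IsBlockCode φ m)
    (hm : m ≤ m') : IsBlockCode φ m' :=
  fun x x' i i' hx => h x x' i i' fun j hj => hx j (hj.trans (by exact_mod_cast hm))

/-- The shift of a point of a subshift. -/
def shiftPoint (i : ℤ) (x : X.carrier) : X.carrier :=
  ⟨SymbolicDynamics.FullShift.shift i x.1, X.mapsTo i x.2⟩

theorem shiftPoint_shiftPoint (i j : ℤ) (x : X.carrier) :
    shiftPoint i (shiftPoint j x) = shiftPoint (j + i) x := by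
  refine Subtype.ext (funext fun k => ?_)
  change x.1 (j + (i + k)) = x.1 (j + i + k)
  rw [add_assoc]

theorem shiftPoint_zero (x : X.carrier) : shiftPoint 0 x = x := by
  refine Subtype.ext (funext fun k => ?_)
  change x.1 (0 + k) = x.1 k
  rw [zero_add]

theorem map_shiftPoint {φ : X.carrier → Y.carrier}
    (h : ∀ x, φ (shiftPoint 1 x) = shiftPoint 1 (φ x)) (i : ℤ) (x : X.carrier) :
    φ (shiftPoint i x) = shiftPoint i (φ x) := by
  have hn : ∀ (k : ℕ) (x : X.carrier), φ (shiftPoint (k : ℤ) x) = shiftPoint (k : ℤ) (φ x) := by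
    intro k
    induction k with
    | zero => intro x; simp [shiftPoint_zero]
    | succ k ih =>
      intro x
      push_cast
      rw [← shiftPoint_shiftPoint, h, ih, shiftPoint_shiftPoint]
  obtain ⟨k, rfl | rfl⟩ := i.eq_nat_or_neg
  · exact hn k x
  · have := hn k (shiftPoint (-k) x)
    rw [shiftPoint_shiftPoint, neg_add_cancel, shiftPoint_zero] at this
    rw [this, shiftPoint_shiftPoint, add_neg_cancel, shiftPoint_zero]

/-- A continuous shift-commuting map between subshifts is a sliding block code. -/
theorem exists_isBlockCode [Finite A] [DiscreteTopology A] [DiscreteTopology B]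
    {φ : X.carrier → Y.carrier} (hφ : Continuous φ)
    (h : ∀ x, φ (shiftPoint 1 x) = shiftPoint 1 (φ x)) : ∃ m, IsBlockCode φ m := by
  by_contra! hcon
  have : CompactSpace X.carrier := isCompact_iff_compactSpace.1 X.isClosed.isCompact
  -- Pairs that agree on `[-m, m]` but whose images differ at `0`. If no `m` worked, these
  -- decreasing compact sets would share a pair of equal points with different images.
  let C : ℕ → Set (X.carrier × X.carrier) := fun m =>
    (⋂ j : {j : ℤ // |j| ≤ m}, {p | p.1.1 j = p.2.1 j}) ∩ {p | (φ p.1).1 0 ≠ (φ p.2).1 0}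
  have hX : ∀ j : ℤ, Continuous fun x : X.carrier => x.1 j := fun j =>
    (continuous_apply j).comp continuous_subtype_val
  have hY : Continuous fun y : Y.carrier => y.1 0 :=
    (continuous_apply 0).comp continuous_subtype_val
  have hC : ∀ m, IsClosed (C m) := by
    intro m
    have hcont : Continuous fun p : X.carrier × X.carrier => ((φ p.1).1 0, (φ p.2).1 0) :=
      ((hY.comp hφ).comp continuous_fst).prodMk ((hY.comp hφ).comp continuous_snd)
    refine (isClosed_iInter fun j : {j : ℤ // |j| ≤ m} => isClosed_eq ((hX j).comp continuous_fst)
      ((hX j).comp continuous_snd)).inter ?_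
    exact (isClosed_discrete {q : B × B | q.1 ≠ q.2}).preimage hcont
  have hne : (⋂ m, C m).Nonempty := by
    refine IsCompact.nonempty_iInter_of_sequence_nonempty_isCompact_isClosed C ?_ ?_
      (hC 0).isCompact hC
    · rintro m p ⟨hp, hp'⟩
      refine ⟨Set.mem_iInter.2 fun j => ?_, hp'⟩
      exact Set.mem_iInter.1 hp ⟨j.1, j.2.trans (by push_cast; linarith)⟩
    · intro m
      have hm := hcon m
      unfold IsBlockCode at hm
      push Not at hm
      obtain ⟨x, x', i, i', h1, h2⟩ := hm
      refine ⟨(shiftPoint i x, shiftPoint i' x'), Set.mem_iInter.2 fun j => h1 j.1 j.2, ?_⟩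
      change (φ (shiftPoint i x)).1 0 ≠ (φ (shiftPoint i' x')).1 0
      rw [map_shiftPoint h, map_shiftPoint h]
      change (φ x).1 (i + 0) ≠ (φ x').1 (i' + 0)
      rwa [add_zero, add_zero]
  obtain ⟨p, hp⟩ := hne
  rw [Set.mem_iInter] at hp
  have : p.1 = p.2 := Subtype.ext (funext fun j =>
    Set.mem_iInter.1 (hp j.natAbs).1 ⟨j, by simp⟩)
  exact (hp 0).2 (by rw [this])

/-- The map of rays induced by a sliding block code with memory and anticipation `m`, shifted
by `m`. -/
def rayMap (φ : X.carrier → Y.carrier) (m : ℕ) (r : Ray X) : Ray Y :=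
  ofPoint (φ ⟨_, r.exists_ofPoint.choose_spec.choose⟩).2 m

/-- The two-sided extension chosen in `rayMap` is immaterial: after the shift by `m`, the window for
coordinate `k` is `[k, k + 2m]`, which the ray determines. -/
theorem IsBlockCode.rayMap_ofPoint {φ : X.carrier → Y.carrier} {m : ℕ} (h : IsBlockCode φ m)
    (x : X.carrier) (i : ℤ) : rayMap φ m (ofPoint x.2 i) = ofPoint (φ x).2 (i + m) := by
  have hx := (ofPoint x.2 i).exists_ofPoint.choose_spec.choose_spec
  refine Subtype.ext (funext fun k => ?_)
  refine h _ x _ _ fun j hj => ?_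
  obtain ⟨t, ht⟩ := Int.eq_ofNat_of_zero_le (a := m + k + j) (by have := neg_le_of_abs_le hj; omega)
  have := congrFun (congrArg Subtype.val hx) t
  rw [ofPoint_apply, ofPoint_apply] at this
  convert this using 2 <;> omega

theorem IsBlockCode.rayMap_shift {φ : X.carrier → Y.carrier} {m : ℕ} (h : IsBlockCode φ m)
    (r : Ray X) : rayMap φ m (shift r) = shift (rayMap φ m r) := by
  obtain ⟨x, hx, rfl⟩ := r.exists_ofPoint
  have h1 := shift_iterate_ofPoint hx 0 1
  have h2 := shift_iterate_ofPoint (φ ⟨x, hx⟩).2 (0 + m) 1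
  rw [Function.iterate_one] at h1 h2
  rw [h1, h.rayMap_ofPoint ⟨x, hx⟩, h.rayMap_ofPoint ⟨x, hx⟩, h2, add_right_comm]

theorem IsBlockCode.rayMap_rayMap {φ : X.carrier → Y.carrier} {ψ : Y.carrier → X.carrier} {m : ℕ}
    (h : IsBlockCode φ m) (h' : IsBlockCode ψ m) (hψφ : ∀ x, ψ (φ x) = x) (r : Ray X) :
    rayMap ψ m (rayMap φ m r) = shift^[m + m] r := by
  obtain ⟨x, hx, rfl⟩ := r.exists_ofPoint
  rw [h.rayMap_ofPoint ⟨x, hx⟩, h'.rayMap_ofPoint, shift_iterate_ofPoint]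
  refine Subtype.ext (funext fun k => ?_)
  rw [ofPoint_apply, ofPoint_apply, hψφ]
  exact congrArg x (by push_cast; ring)

theorem IsBlockCode.pre_rayMap {φ : X.carrier → Y.carrier} {m : ℕ} (h : IsBlockCode φ m) (k : ℕ)
    (r r' : Ray X) (hr : pre (k + (m + m)) r = pre (k + (m + m)) r') :
    pre k (rayMap φ m r) = pre k (rayMap φ m r') := by
  obtain ⟨x, hx, rfl⟩ := r.exists_ofPoint
  obtain ⟨x', hx', rfl⟩ := r'.exists_ofPoint
  rw [h.rayMap_ofPoint ⟨x, hx⟩, h.rayMap_ofPoint ⟨x', hx'⟩, pre_eq_pre_iff]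
  intro i hi
  refine h _ _ _ _ fun j hj => ?_
  rw [abs_le] at hj
  obtain ⟨t, ht⟩ := Int.eq_ofNat_of_zero_le (a := m + i + j) (by omega)
  have := pre_eq_pre_iff.1 hr t (by omega)
  rw [ofPoint_apply, ofPoint_apply] at this
  convert this using 2 <;> omega

/-- Topologically conjugate subshifts have eventually conjugate ray spaces. -/
theorem TopologicallyConjugate.exists_rayConj [Finite A] [DiscreteTopology A] [Finite B]
    [DiscreteTopology B] (h : TopologicallyConjugate X Y) : ∃ n, Nonempty (RayConj X Y n) := by
  obtain ⟨φ, hφ⟩ := h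
  have hφ' : ∀ x, φ (shiftPoint 1 x) = shiftPoint 1 (φ x) := fun x => Subtype.ext (hφ x)
  have hψ' : ∀ y, φ.symm (shiftPoint 1 y) = shiftPoint 1 (φ.symm y) := fun y => by
    rw [Homeomorph.symm_apply_eq, hφ', Homeomorph.apply_symm_apply]
  obtain ⟨m, hm⟩ := exists_isBlockCode φ.continuous hφ'
  obtain ⟨m', hm'⟩ := exists_isBlockCode φ.symm.continuous hψ'
  replace hm := hm.mono (le_max_left m m')
  replace hm' := hm'.mono (le_max_right m m')
  exact ⟨_, ⟨⟨rayMap φ (max m m'), rayMap φ.symm (max m m'), hm.rayMap_shift, hm'.rayMap_shift,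
    hm.rayMap_rayMap hm' φ.symm_apply_apply, hm'.rayMap_rayMap hm φ.apply_symm_apply,
    hm.pre_rayMap, hm'.pre_rayMap⟩⟩⟩

end BlockCode

/-! ## Growth rates -/

/-- A bounded factor and a bounded shift of the index do not affect an exponential growth rate. -/
theorem limsup_log_le {a b : ℕ → ℕ} {C d : ℕ} (h : ∀ l, a l ≤ b (l + d) * C) :
    Filter.limsup (fun l : ℕ => ((Real.log (a l) / l : ℝ) : EReal)) Filter.atTop ≤
      Filter.limsup (fun l : ℕ => ((Real.log (b l) / l : ℝ) : EReal)) Filter.atTop := by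
  refine le_of_forall_gt_imp_ge_of_dense fun c hc => ?_
  obtain ⟨q, hq, hqc⟩ := EReal.lt_iff_exists_real_btwn.1 hc
  -- The gap `s - q` absorbs the constant `q * d + log C` once `l` is large.
  obtain ⟨s, hqs, hsc⟩ := EReal.lt_iff_exists_real_btwn.1 hqc
  rw [EReal.coe_lt_coe_iff] at hqs
  refine le_trans ?_ hsc.le
  have hev := Filter.eventually_lt_of_limsup_lt hq
  have hev' := (Filter.tendsto_add_atTop_nat d).eventually hev
  have hlarge := (tendsto_natCast_atTop_atTop (R := ℝ)).eventually_ge_atTop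
    ((q * d + Real.log C) / (s - q))
  refine Filter.limsup_le_of_le (by isBoundedDefault) ?_
  filter_upwards [hev', hlarge, Filter.eventually_gt_atTop 0] with l h1 h2 h3
  rw [EReal.coe_lt_coe_iff] at h1
  rw [EReal.coe_le_coe_iff]
  have hl : (0 : ℝ) < l := by exact_mod_cast h3
  have hq0 : 0 < q := lt_of_le_of_lt (div_nonneg (Real.log_natCast_nonneg _) (by positivity)) h1
  rw [div_le_iff₀ hl]
  rw [div_lt_iff₀ (by positivity)] at h1
  rw [div_le_iff₀ (sub_pos.2 hqs)] at h2
  rcases Nat.eq_zero_or_pos (a l) with ha | ha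
  · rw [ha, Nat.cast_zero, Real.log_zero]
    exact mul_nonneg (hq0.trans hqs).le hl.le
  · have hpos : 0 < b (l + d) * C := ha.trans_le (h l)
    have hb : b (l + d) ≠ 0 := (Nat.pos_of_mul_pos_right hpos).ne'
    have hC : C ≠ 0 := (Nat.pos_of_mul_pos_left hpos).ne'
    have h4 : Real.log (a l) ≤ Real.log (b (l + d)) + Real.log C := by
      rw [← Real.log_mul (by exact_mod_cast hb) (by exact_mod_cast hC)]
      exact Real.log_le_log (by exact_mod_cast ha) (by exact_mod_cast h l)
    push_cast at h1
    nlinarith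

/-! ## Labeled paths -/

namespace LambdaGraphSystem

variable {A : Type u} {L : LambdaGraphSystem A}

/-- The label of a path. -/
def Path.word : ∀ {l : ℕ} {v : L.V l}, L.Path l v → List A
  | _, _, .nil _ => []
  | _, _, .cons e p => p.word ++ [L.label e]

end LambdaGraphSystem

section Paths

variable {A : Type u} [TopologicalSpace A] [Finite A] [DiscreteTopology A]
  {X : ZSubshift A} (hX : IsLambdaSynchronizing X)

/-- Both edges come from preimages of the same regular ray with the same first letter, that is, from
the same preimage. -/
theorem edge_ext (hX : IsLambdaSynchronizing X) {l : ℕ} {e e' : Edge X l}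
    (ht : e.1.2.2 = e'.1.2.2) (hl : e.1.2.1 = e'.1.2.1) : e = e' := by
  obtain ⟨r, hr⟩ := Reg.vtx_surjective hX (l + 1) e.1.2.2
  obtain ⟨r1, h1, h2⟩ := Reg.exists_of_edge e hr.symm
  obtain ⟨r1', h1', h2'⟩ := Reg.exists_of_edge e' (hr.trans ht).symm
  have : r1 = r1' := by
    refine Subtype.ext (eq_of_pre_of_shift (l := 1) ?_ (Eq.trans h1 (Eq.symm h1')))
    rw [h2, h2'] at hl
    simpa [pre] using hl
  exact Subtype.ext (by rw [h2, h2', this])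

/-- Lift the path backwards from `r`, one shift preimage per edge. With `exists_path_of_ray`, this
identifies the words of paths ending at a vertex with the past words of a ray representing it. -/
theorem exists_ray_of_path (l : ℕ) : ∀ (p : (lambdaSyncSystem X hX).PathsTo l) (r : Reg X),
    Reg.vtx l r = p.1 → ∃ r' : Ray X, shift^[l] r' = r.1 ∧ p.2.word = pre l r' := by
  induction l with
  | zero =>
    rintro ⟨v, p⟩ r -
    cases p
    exact ⟨r.1, rfl, rfl⟩
  | succ l ih =>
    rintro ⟨v, p⟩ r hr
    cases p with
    | cons e p =>
      obtain ⟨r1, h1, h2⟩ := Reg.exists_of_edge e hr.symm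
      obtain ⟨r', h3, h4⟩ := ih ⟨_, p⟩ r1 (congrArg Prod.fst h2).symm
      refine ⟨r', ?_, ?_⟩
      · rw [Function.iterate_succ_apply', h3, h1]
      · rw [pre_add, h3, ← h4]
        refine congrArg (p.word ++ ·) ?_
        change [e.1.2.1] = [r1.1.1 0]
        rw [h2]

theorem exists_path_of_ray (l : ℕ) : ∀ (r' : Ray X) (r : Reg X), shift^[l] r' = r.1 →
    ∃ p : (lambdaSyncSystem X hX).Path l (Reg.vtx l r), p.word = pre l r' := by
  induction l with
  | zero => exact fun r' r h => ⟨.nil _, rfl⟩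
  | succ l ih =>
    intro r' r h
    rw [Function.iterate_succ_apply'] at h
    have hreg : IsRegular (shift^[l] r') := .of_shift (by rw [h]; exact r.2)
    obtain ⟨p, hp⟩ := ih r' ⟨_, hreg⟩ rfl
    obtain ⟨⟨_, he⟩, rfl⟩ := Reg.exists_edge l (r' := ⟨_, hreg⟩) h
    refine ⟨.cons (L := lambdaSyncSystem X hX) ⟨_, he⟩ p, ?_⟩
    rw [pre_add, ← hp]
    rfl

theorem path_ext (l : ℕ) : ∀ p q : (lambdaSyncSystem X hX).PathsTo l,
    p.1 = q.1 → p.2.word = q.2.word → p = q := by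
  induction l with
  | zero =>
    rintro ⟨v, p⟩ ⟨w, q⟩ h -
    cases p
    cases q
    dsimp only at h
    rw [h]
  | succ l ih =>
    rintro ⟨v, p⟩ ⟨w, q⟩ h hw
    cases p with
    | cons e p =>
      cases q with
      | cons e' q =>
        obtain ⟨h1, h2⟩ := List.append_inj' (s₁ := p.word) (s₂ := q.word) hw rfl
        obtain rfl : e = e' := edge_ext hX h (List.singleton_inj.1 h2)
        obtain rfl : p = q := eq_of_heq (Sigma.mk.inj (ih ⟨_, p⟩ ⟨_, q⟩ rfl h1)).2
        rfl

theorem finite_pathsTo (l : ℕ) : Finite ((lambdaSyncSystem X hX).PathsTo l) := by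
  have := finite_vertex (X := X) l
  have := (List.finite_length_eq A l).to_subtype
  let f : (lambdaSyncSystem X hX).PathsTo l → Vertex X l × {w : List A | w.length = l} :=
    fun p => (p.1, ⟨p.2.word, by
      obtain ⟨r, hr⟩ := Reg.vtx_surjective hX l p.1
      obtain ⟨r', -, h⟩ := exists_ray_of_path hX l p r hr
      rw [h]
      exact length_pre l r'⟩)
  refine Finite.of_injective f fun p q h => path_ext hX l p q (congrArg Prod.fst h) ?_
  exact congrArg Subtype.val (congrArg Prod.snd h)

end Paths

/-! ## Entropies -/

namespace RayConj

/-- The possible values of `code n`. -/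
abbrev Codes (A : Type u) (B : Type v) (n : ℕ) : Type (max u v) :=
  {w : List B | w.length = n} × {w : List A | w.length = n}

theorem finite_codes (A : Type u) [Finite A] (B : Type v) [Finite B] (n : ℕ) :
    Finite (Codes A B n) := by
  have := (List.finite_length_eq A n).to_subtype
  have := (List.finite_length_eq B n).to_subtype
  infer_instance

section

variable {A : Type u} [TopologicalSpace A] {B : Type v} [TopologicalSpace B]
  {X : ZSubshift A} {Y : ZSubshift B} {n : ℕ}

/-- The code of a ray as an element of a finite type. -/
def codeOf (e : RayConj X Y n) (x : Ray X) : Codes A B n :=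
  (⟨(e.code n x).1, length_pre _ _⟩, ⟨(e.code n x).2, length_pre _ _⟩)

theorem code_eq_of_codeOf_eq (e : RayConj X Y n) {x x' : Ray X} (h : e.codeOf x = e.codeOf x') :
    e.code n x = e.code n x' :=
  Prod.ext (congrArg Subtype.val (congrArg Prod.fst h))
    (congrArg Subtype.val (congrArg Prod.snd h))

/-- Regularity is only known to pull back along `e.map n`, so `x` is replaced by a ray with the same
past of length `l` and regular image. -/
theorem exists_isRegular_map [Finite B] [DiscreteTopology B] (e : RayConj X Y n)
    (hY : IsLambdaSynchronizing Y) (l : ℕ) (x : Reg X) :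
    ∃ x' : Reg X, past l x'.1 = past l x.1 ∧ IsRegular (e.map n x'.1) := by
  obtain ⟨k, hk⟩ := x.2 l
  obtain ⟨x0, hx0⟩ := exists_shift_iterate n x.1
  -- The first `n + k` letters make `e.G y` agree with `x` on `k` letters. As `e.map n (e.G y)` is
  -- `shift^[n + n] y`, it becomes regular after `k` more shifts, hence is regular.
  obtain ⟨y, h1, h2⟩ := exists_isRegular hY (pre_mem_language (n + n + k) (e.F x0))
  rw [length_pre] at h1 h2
  have h3 : pre k (e.G y) = pre k x.1 := by
    rw [← hx0, ← e.G_F]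
    exact e.G_local k _ _ (pre_mono (by omega) h1)
  have h4 : IsRegular (e.map n (e.G y)) := by
    unfold map
    rw [e.F_G, ← Function.iterate_add_apply]
    refine Ray.IsRegular.of_shift_iterate (k := k) ?_
    rwa [← Function.iterate_add_apply, add_comm]
  exact ⟨⟨e.G y, isRegular_of_map le_rfl h4⟩, hk _ h3, h4⟩

end

variable {A : Type u} [TopologicalSpace A] [Finite A] [DiscreteTopology A]
  {B : Type v} [TopologicalSpace B] [Finite B] [DiscreteTopology B]
  {X : ZSubshift A} {Y : ZSubshift B} {n : ℕ}

/-- A vertex is recovered, by `past_eq`, from the vertex of the image `n + n` levels deeper and the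
code. -/
theorem card_vertex_le (e : RayConj X Y n) (hX : IsLambdaSynchronizing X)
    (hY : IsLambdaSynchronizing Y) (l : ℕ) :
    Nat.card (Vertex X l) ≤ Nat.card (Vertex Y (l + (n + n))) * Nat.card (Codes A B n) := by
  have := finite_vertex (X := Y) (l + (n + n))
  have := finite_codes A B n
  have key : ∀ v : Vertex X l, ∃ x : Reg X, Reg.vtx l x = v ∧ IsRegular (e.map n x.1) := by
    intro v
    obtain ⟨x, rfl⟩ := Reg.vtx_surjective hX l v
    obtain ⟨x', h1, h2⟩ := e.exists_isRegular_map hY l x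
    exact ⟨x', Reg.vtx_eq_iff.2 h1, h2⟩
  choose x hx hreg using key
  rw [← Nat.card_prod]
  refine Nat.card_le_card_of_injective
    (fun v => (Reg.vtx (l + (n + n)) (⟨_, hreg v⟩ : Reg Y), e.codeOf (x v).1)) fun v w h => ?_
  have h1 := Reg.vtx_eq_iff.1 (congrArg Prod.fst h)
  rw [← add_assoc] at h1
  rw [← hx v, ← hx w]
  exact Reg.vtx_eq_iff.2 (past_eq le_rfl h1 (e.code_eq_of_codeOf_eq (congrArg Prod.snd h)))

/-- The end of the path is recovered as for vertices, its word by applying `G` to a ray starting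
with the word of the image path; by `path_ext` these two determine the path. -/
theorem card_pathsTo_le (e : RayConj X Y n) (hX : IsLambdaSynchronizing X)
    (hY : IsLambdaSynchronizing Y) (l : ℕ) :
    Nat.card ((lambdaSyncSystem X hX).PathsTo l) ≤
      Nat.card ((lambdaSyncSystem Y hY).PathsTo (l + (n + n))) * Nat.card (Codes A B n) := by
  have := finite_pathsTo hY (l + (n + n))
  have := finite_codes A B n
  have key : ∀ p : (lambdaSyncSystem X hX).PathsTo l,
      ∃ (x : Reg X) (hreg : IsRegular (e.map n x.1)) (y : Ray Y)
        (q : (lambdaSyncSystem Y hY).Path (l + (n + n)) (Reg.vtx _ (⟨_, hreg⟩ : Reg Y))),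
        Reg.vtx l x = p.1 ∧ p.2.word = pre l (e.G y) ∧ q.word = pre (l + (n + n)) y := by
    intro p
    obtain ⟨x, hx⟩ := Reg.vtx_surjective hX l p.1
    obtain ⟨x', h1, h2⟩ := e.exists_isRegular_map hY l x
    have h3 : Reg.vtx l x' = p.1 := (Reg.vtx_eq_iff.2 h1).trans hx
    obtain ⟨z, hz, hp⟩ := exists_ray_of_path hX l p x' h3
    obtain ⟨y, rfl, h5⟩ := e.exists_G_eq l n z
    rw [hz, add_assoc] at h5
    obtain ⟨q, hq⟩ := exists_path_of_ray hY (l + (n + n)) y ⟨_, h2⟩ h5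
    exact ⟨x', h2, y, q, h3, hp, hq⟩
  choose x hreg y q hx hp hq using key
  rw [← Nat.card_prod]
  refine Nat.card_le_card_of_injective
    (fun p => ((⟨_, q p⟩ : (lambdaSyncSystem Y hY).PathsTo _), e.codeOf (x p).1)) fun p p' h => ?_
  have hpath := congrArg Prod.fst h
  have h1 := Reg.vtx_eq_iff.1 (congrArg Sigma.fst hpath)
  have h2 : (q p).word = (q p').word :=
    congrArg (fun s : (lambdaSyncSystem Y hY).PathsTo _ => s.2.word) hpath
  rw [hq, hq, ← add_assoc] at h2
  rw [← add_assoc] at h1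
  refine path_ext hX l p p' ?_ ?_
  · rw [← hx p, ← hx p']
    exact Reg.vtx_eq_iff.2 (past_eq le_rfl h1 (e.code_eq_of_codeOf_eq (congrArg Prod.snd h)))
  · rw [hp, hp]
    exact pre_G_eq h2

theorem lambdaEntropy_le (e : RayConj X Y n) (hX : IsLambdaSynchronizing X)
    (hY : IsLambdaSynchronizing Y) :
    (lambdaSyncSystem X hX).lambdaEntropy ≤ (lambdaSyncSystem Y hY).lambdaEntropy :=
  limsup_log_le (e.card_vertex_le hX hY)

theorem volumeEntropy_le (e : RayConj X Y n) (hX : IsLambdaSynchronizing X)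
    (hY : IsLambdaSynchronizing Y) :
    (lambdaSyncSystem X hX).volumeEntropy ≤ (lambdaSyncSystem Y hY).volumeEntropy :=
  limsup_log_le (e.card_pathsTo_le hX hY)

end RayConj

end LambdaSync

end

/-! ### Invariance under conjugacy. -/

theorem corollary3p6 {A B : Type*}
    [Finite A] [TopologicalSpace A] [DiscreteTopology A]
    [Finite B] [TopologicalSpace B] [DiscreteTopology B]
    (X : LambdaSync.ZSubshift A) (Y : LambdaSync.ZSubshift B)
    (hX : LambdaSync.IsLambdaSynchronizing X) (hY : LambdaSync.IsLambdaSynchronizing Y)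
    (hXY : LambdaSync.TopologicallyConjugate X Y) :
    Nonempty ((LambdaSync.lambdaMatrixSystem X hX).K0 ≃+
      (LambdaSync.lambdaMatrixSystem Y hY).K0) ∧
    Nonempty ((LambdaSync.lambdaMatrixSystem X hX).K1 ≃+
      (LambdaSync.lambdaMatrixSystem Y hY).K1) ∧
    Nonempty ((LambdaSync.lambdaMatrixSystem X hX).BF0 ≃+
      (LambdaSync.lambdaMatrixSystem Y hY).BF0) ∧
    Nonempty ((LambdaSync.lambdaMatrixSystem X hX).BF1 ≃+
      (LambdaSync.lambdaMatrixSystem Y hY).BF1) ∧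
    (∃ e : (LambdaSync.lambdaMatrixSystem X hX).Delta ≃+
        (LambdaSync.lambdaMatrixSystem Y hY).Delta,
      e '' (LambdaSync.lambdaMatrixSystem X hX).DeltaPos =
        (LambdaSync.lambdaMatrixSystem Y hY).DeltaPos) ∧
    (LambdaSync.lambdaSyncSystem X hX).lambdaEntropy =
      (LambdaSync.lambdaSyncSystem Y hY).lambdaEntropy ∧
    (LambdaSync.lambdaSyncSystem X hX).volumeEntropy =
      (LambdaSync.lambdaSyncSystem Y hY).volumeEntropy := by
  obtain ⟨n, ⟨e⟩⟩ := hXY.exists_rayConj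
  obtain ⟨R, S, h, hR, hS⟩ := e.exists_isShiftEquiv hX hY
  -- Dualizing the shift equivalence of the `λ`'s gives one of the endomorphisms `M` of the
  -- projective limits.
  have hdual := (h.dual ℤ).conj (LambdaSync.lambdaMatrixSystem X hX).dualEquiv
    (LambdaSync.lambdaMatrixSystem Y hY).dualEquiv
    (LambdaSync.lambdaMatrixSystem X hX).toDual_Mend
    (LambdaSync.lambdaMatrixSystem Y hY).toDual_Mend
  exact ⟨⟨h.cokerEquiv⟩, ⟨h.kerEquiv⟩, ⟨hdual.cokerEquiv⟩, ⟨hdual.kerEquiv⟩,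
    ⟨h.limEquiv, h.limEquiv_image hR hS⟩,
    (e.lambdaEntropy_le hX hY).antisymm (e.symm.lambdaEntropy_le hY hX),
    (e.volumeEntropy_le hX hY).antisymm (e.symm.volumeEntropy_le hY hX)⟩
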